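/- \textbf{Theorem (Generalized Lie Theorem).} Let $n\ge 0$, let $\Lambda$ be any set and let $(Y_\alpha)_{\alpha\in\Lambda}$ be a family of $C^\infty$ time-dependent vector fields $Y_\alpha:\mathbb R\times\mathbb R^n\to\mathbb R^n$, with associated systems $dx/dt=Y_\alpha(t,x)$. For a time-dependent vector field $Z=\sum_i Z^i(t,x)\,\partial/\partial x^i$ let $\bar Z=\partial/\partial t+\sum_i Z^i(t,x)\,\partial/\partial x^i$ be its autonomization, a vector field on $\mathbb R\times\mathbb R^n$. For $m\ge 0$ and $(t_0,p)\in\mathbb R\times(\mathbb R^n)^m$, a \emph{common superposition rule around $(t_0,p)$} is a $C^\infty$ map $\Phi:\Omega\to\mathbb R^n$, $(t,x_{(1)},\dots,x_{(m)};k)\mapsto\Phi(t,x_{(1)},\dots,x_{(m)};k)$, on an open set $\Omega\subseteq\mathbb R\times(\mathbb R^n)^m\times\mathbb R^n$ such that (a) for all fixed $(t,x_{(1)},\dots,x_{(m)})$ the map $k\mapsto\Phi(t,x_{(1)},\dots,x_{(m)};k)$ is injective with invertible derivative where it is defined; (b) for every $\alpha$, every constant $k\in\mathbb R^n$ and all solutions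 $x_{(1)},\dots,x_{(m)}$ of $Y_\alpha$ on an open interval $J$ with $(t,x_{(1)}(t),\dots,x_{(m)}(t),k)\in\Omega$ for $t\in J$, the curve $t\mapsto\Phi(t,x_{(1)}(t),\dots,x_{(m)}(t);k)$ is a solution of $Y_\alpha$ on $J$; (c) for every $\alpha$, all solutions $x_{(1)},\dots,x_{(m)}$ of $Y_\alpha$ on an open interval containing $t_0$ with $(x_{(1)}(t_0),\dots,x_{(m)}(t_0))=p$, and every solution $x$ of $Y_\alpha$ on that interval, there is $k\in\mathbb R^n$ with $(t_0,p,k)\in\Omega$ and $x(t)=\Phi(t,x_{(1)}(t),\dots,x_{(m)}(t);k)$ for all $t$ close to $t_0$. The family \emph{admits a common time-dependent superposition rule} (is a \emph{Lie family}) if there are $m\ge0$ and an open set $W\subseteq\mathbb R\times(\mathbb R^n)^m$ of ``generic'' configurations, whose projection to the time axis $\mathbb R$ is dense, such that there is a common superposition rule around every $(t_0,p)\in W$. Then $(Y_\alpha)_{\alpha\in\Lambda}$ is a Lie family if and only if there are $r\ge 0$, $C^\infty$ time-dependent vector fields $X_1,\dots,X_r$ on $\mathbb R^n$, functions $f_{jkl}:\mathbb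 R\to\mathbb R$ $(1\le j,k,l\le r)$ and functions $b_{\alpha j}:\mathbb R\to\mathbb R$ $(\alpha\in\Lambda,\ 1\le j\le r)$ such that, on all of $\mathbb R\times\mathbb R^n$, $$[\bar X_j,\bar X_k](t,x)=\sum_{l=1}^r f_{jkl}(t)\,\bar X_l(t,x),\qquad j,k=1,\dots,r,$$ $$\bar Y_\alpha(t,x)=\sum_{j=1}^r b_{\alpha j}(t)\,\bar X_j(t,x),\qquad \sum_{j=1}^r b_{\alpha j}(t)=1,\qquad \alpha\in\Lambda .$$ -/

import Mathlib

open Set Filter Topology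
open scoped ContDiff

/-- Time-dependent vector fields on `ℝⁿ`; equivalently, right-hand sides `Y t x` of
non-autonomous first-order systems `dx/dt = Y(t, x)`. -/
abbrev TDVectorField (n : ℕ) : Type := ℝ → (Fin n → ℝ) → (Fin n → ℝ)

/-- Joint smoothness in `(t, x)`. -/
def TDVectorField.Smooth {n : ℕ} (Y : TDVectorField n) : Prop :=
  ContDiff ℝ ∞ (fun q : ℝ × (Fin n → ℝ) => Y q.1 q.2)

/-- The autonomization `∂/∂t + ∑ᵢ Yⁱ(t, x) ∂/∂xⁱ`, a vector field on `ℝ × ℝⁿ`. -/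
def TDVectorField.autonomization {n : ℕ} (Y : TDVectorField n) :
    ℝ × (Fin n → ℝ) → ℝ × (Fin n → ℝ) :=
  fun q => (1, Y q.1 q.2)

/-- The curve `x` is a solution of `dx/dt = Y(t, x)` on the open interval `(a, b)`. -/
def TDVectorField.IsSolution {n : ℕ} (Y : TDVectorField n) (a b : ℝ) (x : ℝ → Fin n → ℝ) :
    Prop :=
  ∀ t ∈ Ioo a b, HasDerivAt x (Y t (x t)) t

/-- `Φ`, defined on the open set `Ω` of points `(t, x₍₁₎, …, x₍ₘ₎, k)`, is a (local) common
time-dependent superposition rule for the family `Y` around the configuration `p` of `m` points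
at the time `t₀`. -/
structure IsSuperpositionRuleAt {n : ℕ} {Λ : Type*} (Y : Λ → TDVectorField n) {m : ℕ}
    (t₀ : ℝ) (p : Fin m → Fin n → ℝ) (Ω : Set (ℝ × (Fin m → Fin n → ℝ) × (Fin n → ℝ)))
    (Φ : ℝ → (Fin m → Fin n → ℝ) → (Fin n → ℝ) → (Fin n → ℝ)) : Prop where
  isOpen_domain : IsOpen Ω
  smooth : ContDiffOn ℝ ∞ (fun q : ℝ × (Fin m → Fin n → ℝ) × (Fin n → ℝ) =>
    Φ q.1 q.2.1 q.2.2) Ω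
  /-- The constants `k` are determined by the point `Φ(t, x; k)`. -/
  injective : ∀ t x k k', (t, x, k) ∈ Ω → (t, x, k') ∈ Ω → Φ t x k = Φ t x k' → k = k'
  /-- `Φ` is regular with respect to the constants. -/
  regular : ∀ t x k, (t, x, k) ∈ Ω → Function.Bijective (fderiv ℝ (Φ t x) k)
  /-- Inserting `m` solutions of one of the systems and fixed constants gives a solution of the
  same system. -/
  solves : ∀ (α : Λ) (a b : ℝ) (x : Fin m → ℝ → Fin n → ℝ) (k : Fin n → ℝ),
    (∀ i, (Y α).IsSolution a b (x i)) →
    (∀ t ∈ Ioo a b, (t, (fun i => x i t), k) ∈ Ω) →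
    (Y α).IsSolution a b (fun t => Φ t (fun i => x i t) k)
  /-- Every solution of a system of the family is obtained, near `t₀`, from any `m` solutions of
  that system that pass through `p` at `t₀`, for suitable constants. -/
  general : ∀ (α : Λ) (a b : ℝ) (x : Fin m → ℝ → Fin n → ℝ) (y : ℝ → Fin n → ℝ),
    t₀ ∈ Ioo a b → (∀ i, (Y α).IsSolution a b (x i)) → (∀ i, x i t₀ = p i) →
    (Y α).IsSolution a b y →
    ∃ k, (t₀, p, k) ∈ Ω ∧ ∀ᶠ t in 𝓝 t₀, y t = Φ t (fun i => x i t) k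

/-- The family `Y` admits a common time-dependent superposition rule (is a Lie family): for some
number `m` there is an open set `W` of generic configurations `(t₀, x₍₁₎, …, x₍ₘ₎)`, present at a
dense set of times `t₀`, around each of which there is such a rule. -/
def IsLieFamily {n : ℕ} {Λ : Type*} (Y : Λ → TDVectorField n) : Prop :=
  ∃ (m : ℕ) (W : Set (ℝ × (Fin m → Fin n → ℝ))),
    IsOpen W ∧ Dense (Prod.fst '' W) ∧
    ∀ t₀ p, (t₀, p) ∈ W → ∃ Ω Φ, IsSuperpositionRuleAt Y t₀ p Ω Φ

/-! From fields to a rule: the structure functions depend on `t` alone, and all points of a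
configuration share the same `t`, so the diagonal prolongations of the `X̄ⱼ` to any number of points
obey the same bracket relations. With `m = r` points, over a dense set of times there are
configurations near which every combination vanishing on the prolongation vanishes identically at
that time (`genericConfigurations`). There the distribution for `m + 1` points is integrable and
projects isomorphically onto the one for `m` points. Moving along its leaves from a transversal
carries the last point by a local diffeomorphism `k ↦ Φ(t, x; k)` (`exists_leaf_transport`).
Prolonged solutions of `Y_α` run inside leaves, so `Φ` is a superposition rule. The leaves come from
a Frobenius theorem (`exists_frobenius`), proved by the inverse function theorem on a Banach space
of curves.

From a rule to fields: the rules define leaves `k = const` to which each `Ȳ_α` is tangent. Let `T t`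
be the space of vertical fields tangent at time `t` to the leaves of all the rules. Differences `Y_α
- Y_α₀` and brackets of tangent autonomizations have values in `T t`. Since `Φ(t, p; ·)` is onto, a
member of `T t` is determined by its values at the `m` points of `p`, so at most `m * n` smooth
sections of `T` are independent at any time. A Besicovitch covering of the time axis glues local
systems into finitely many global sections spanning at every time (`exists_spanning_sections`), even
where the rank jumps. Adding `Y_α₀` to them yields the `X j`. -/

/-! ### Smoothness of post-composition on spaces of continuous curves. -/

section Nemytskii

universe u

variable {K : Type*} [TopologicalSpace K] [CompactSpace K] {E F : Type u} [NormedAddCommGroup E]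
  [NormedSpace ℝ E] [NormedAddCommGroup F] [NormedSpace ℝ F]

/-- Pointwise application of a continuous family of operators, as a bilinear map. -/
noncomputable def pointwiseApply : C(K, E →L[ℝ] F) →L[ℝ] C(K, E) →L[ℝ] C(K, F) :=
  LinearMap.mkContinuous₂ (LinearMap.mk₂ ℝ
    (fun (A : C(K, E →L[ℝ] F)) (h : C(K, E)) =>
      (⟨fun τ => A τ (h τ), A.continuous.clm_apply h.continuous⟩ : C(K, F)))
    (fun A B h => by ext; simp) (fun c A h => by ext; simp)
    (fun A h g => by ext; simp) (fun c A h => by ext; simp)) 1 (fun A h => by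
      rw [one_mul]
      refine (ContinuousMap.norm_le _ (by positivity)).2 fun τ => ?_
      exact ((A τ).le_opNorm (h τ)).trans
        (mul_le_mul (A.norm_coe_le_norm τ) (h.norm_coe_le_norm τ) (norm_nonneg _) (norm_nonneg A)))

@[simp] theorem pointwiseApply_apply (A : C(K, E →L[ℝ] F)) (h : C(K, E)) (τ : K) :
    pointwiseApply A h τ = A τ (h τ) := rfl

theorem hasFDerivAt_postcomp (f : C(E, F)) (f' : C(E, E →L[ℝ] F))
    (hf : ∀ x, HasFDerivAt f (f' x) x) (γ : C(K, E)) :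
    HasFDerivAt (fun γ : C(K, E) => f.comp γ) (pointwiseApply (f'.comp γ)) γ := by
  rw [hasFDerivAt_iff_isLittleO_nhds_zero, Asymptotics.isLittleO_iff]
  intro ε hε
  have hc : ContinuousAt (fun γ : C(K, E) => f'.comp γ) γ :=
    (ContinuousMap.continuous_postcomp f').continuousAt
  obtain ⟨δ, hδ, H⟩ := (Metric.continuousAt_iff (α := C(K, E))
    (β := C(K, E →L[ℝ] F))).1 hc ε hε
  filter_upwards [Metric.ball_mem_nhds (0 : C(K, E)) hδ] with h hh
  rw [mem_ball_zero_iff] at hh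
  refine (ContinuousMap.norm_le _ (by positivity)).2 fun τ => ?_
  have key := (convex_ball (γ τ) δ).norm_image_sub_le_of_norm_hasFDerivWithin_le'
    (f := f) (f' := fun x => f' x) (φ := f' (γ τ)) (C := ε)
    (fun x _ => (hf x).hasFDerivWithinAt) (fun x hx => by
      -- Continuity of `γ ↦ f' ∘ γ` in the sup norm, tested on the translate of `γ` through `x` at
      -- `τ`, bounds `f' x - f' (γ τ)` with one `δ` for all `τ`.
      have h1 : dist (γ + ContinuousMap.const K (x - γ τ)) γ < δ := by
        rw [dist_eq_norm, add_sub_cancel_left]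
        refine (ContinuousMap.norm_lt_iff _ hδ).2 fun _ => ?_
        simpa [dist_eq_norm] using hx
      have h2 := (ContinuousMap.dist_lt_iff hε).1 (H h1) τ
      rw [dist_eq_norm] at h2
      simpa using h2.le) (x := γ τ) (y := γ τ + h τ) (Metric.mem_ball_self hδ)
      (by simpa [dist_eq_norm] using (h.norm_coe_le_norm τ).trans_lt hh)
  rw [add_sub_cancel_left] at key
  refine le_trans ?_ (key.trans (mul_le_mul_of_nonneg_left (h.norm_coe_le_norm τ) hε.le))
  simp

/-- The derivative is post-composition with `f'` followed by a bounded linear map, so the induction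
passes from `F` to `E →L[ℝ] F`; this is why `E` and `F` share a universe. -/
theorem contDiff_postcomp_nat (n : ℕ) : ∀ {F : Type u} [NormedAddCommGroup F] [NormedSpace ℝ F]
    (f : C(E, F)), ContDiff ℝ n f → ContDiff ℝ n (fun γ : C(K, E) => f.comp γ) := by
  induction n with
  | zero => intro F _ _ f _; exact contDiff_zero.2 (ContinuousMap.continuous_postcomp f)
  | succ n ih =>
    intro F _ _ f hf
    have hf1 := (contDiff_succ_iff_fderiv (n := (n : ℕ∞ω))).1 (by exact_mod_cast hf)
    let f' : C(E, E →L[ℝ] F) := ⟨fderiv ℝ f, hf1.2.2.continuous⟩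
    have hd : ∀ γ : C(K, E), HasFDerivAt (fun γ : C(K, E) => f.comp γ)
        (pointwiseApply (f'.comp γ)) γ :=
      hasFDerivAt_postcomp f f' fun x => (hf1.1 x).hasFDerivAt
    have h := (contDiff_succ_iff_fderiv (𝕜 := ℝ) (f := fun γ : C(K, E) => f.comp γ)
      (n := (n : ℕ∞ω))).2 ⟨fun γ => (hd γ).differentiableAt, by simp, by
        have : fderiv ℝ (fun γ : C(K, E) => f.comp γ) = fun γ => pointwiseApply (f'.comp γ) :=
          funext fun γ => (hd γ).fderiv
        rw [this]
        exact pointwiseApply.contDiff.comp (ih f' hf1.2.2)⟩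
    exact_mod_cast h

theorem contDiff_postcomp (f : C(E, F)) (hf : ContDiff ℝ ∞ f) :
    ContDiff ℝ ∞ (fun γ : C(K, E) => f.comp γ) :=
  contDiff_infty.2 fun n => contDiff_postcomp_nat n f (hf.of_le (by exact_mod_cast le_top))

end Nemytskii

/-! ### Integration as a bounded operator on curves. -/

section Primitive

variable {E : Type*} [NormedAddCommGroup E] [NormedSpace ℝ E]

/-- The primitive vanishing at `0` of a continuous curve on the unit interval. -/
noncomputable def primitive : C(Icc (0 : ℝ) 1, E) →L[ℝ] C(Icc (0 : ℝ) 1, E) :=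
  LinearMap.mkContinuous
    { toFun := fun γ => ⟨fun τ => ∫ s in (0 : ℝ)..τ, IccExtend zero_le_one γ s,
        (intervalIntegral.continuous_primitive
          (fun a b => (γ.continuous.Icc_extend' (h := zero_le_one)).intervalIntegrable a b) 0).comp
          continuous_subtype_val⟩
      map_add' := fun γ₁ γ₂ => by
        ext τ
        exact intervalIntegral.integral_add
          ((γ₁.continuous.Icc_extend' (h := zero_le_one)).intervalIntegrable _ _)
          ((γ₂.continuous.Icc_extend' (h := zero_le_one)).intervalIntegrable _ _)
      map_smul' := fun c γ => by
        ext τ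
        exact intervalIntegral.integral_smul c _ } 1 (fun γ => by
      rw [one_mul]
      refine (ContinuousMap.norm_le _ (norm_nonneg _)).2 fun τ => ?_
      refine (intervalIntegral.norm_integral_le_of_norm_le_const (C := ‖γ‖)
        fun s _ => γ.norm_coe_le_norm _).trans ?_
      rw [sub_zero, abs_of_nonneg τ.2.1]
      exact mul_le_of_le_one_right (norm_nonneg _) τ.2.2)

theorem primitive_apply (γ : C(Icc (0 : ℝ) 1, E)) (τ : Icc (0 : ℝ) 1) :
    primitive γ τ = ∫ s in (0 : ℝ)..τ, IccExtend zero_le_one γ s := rfl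

theorem hasDerivAt_integral_IccExtend [CompleteSpace E] (w : C(Icc (0 : ℝ) 1, E)) (s : ℝ) :
    HasDerivAt (fun s : ℝ => ∫ τ in (0 : ℝ)..s, IccExtend zero_le_one w τ)
      (IccExtend zero_le_one w s) s :=
  ((w.continuous.Icc_extend' (h := zero_le_one)).integral_hasStrictDerivAt 0 s).hasDerivAt

/-- A differentiable curve is the primitive of its derivative. -/
theorem primitive_eq_of_hasDerivAt [CompleteSpace E] {g : ℝ → E} (w v : C(Icc (0 : ℝ) 1, E))
    (hg : ∀ s (hs : s ∈ Icc (0 : ℝ) 1), HasDerivAt g (w ⟨s, hs⟩) s)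
    (hv : ∀ τ : Icc (0 : ℝ) 1, v τ = g τ - g 0) : primitive w = v := by
  ext τ
  rw [primitive_apply, hv]
  refine intervalIntegral.integral_eq_sub_of_hasDerivAt (fun s hs => ?_)
    ((w.continuous.Icc_extend' (h := zero_le_one)).intervalIntegrable _ _)
  rw [uIcc_of_le τ.2.1] at hs
  have hs' : s ∈ Icc (0 : ℝ) 1 := ⟨hs.1, hs.2.trans τ.2.2⟩
  rw [IccExtend_of_mem _ _ hs']
  exact hg s hs'

end Primitive

/-! ### The Frobenius theorem via the inverse function theorem. -/

section TotalDifferentialEquation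

universe u

variable {P M : Type u} [NormedAddCommGroup P] [NormedSpace ℝ P]
  [NormedAddCommGroup M] [NormedSpace ℝ M]

/-- The integrability condition at `q` for the total differential equation `∂q/∂c = V(q)`. -/
def IsIntegrableAt (V : M → P →L[ℝ] M) (q : M) : Prop :=
  ∀ c d, fderiv ℝ V q (V q d) c = fderiv ℝ V q (V q c) d

/-- The pairing of parameters with curves. -/
noncomputable def constProdCurve : P × C(Icc (0 : ℝ) 1, M) →L[ℝ] C(Icc (0 : ℝ) 1, P × M) :=
  LinearMap.mkContinuous
    { toFun := fun x => (ContinuousMap.const _ x.1).prodMk x.2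
      map_add' := fun _ _ => rfl
      map_smul' := fun _ _ => rfl } 1 fun x => by
        rw [one_mul]
        refine (ContinuousMap.norm_le _ (norm_nonneg _)).2 fun τ => ?_
        exact max_le_max le_rfl (x.2.norm_coe_le_norm τ)

@[simp] theorem constProdCurve_apply (x : P × C(Icc (0 : ℝ) 1, M)) (τ : Icc (0 : ℝ) 1) :
    constProdCurve x τ = (x.1, x.2 τ) := rfl

/-- The map whose fibres over `(c, const q)` are the integral curves of `V(·) c` starting
at `q`. -/
noncomputable def integralDefect (W : C(P × M, M)) (x : P × C(Icc (0 : ℝ) 1, M)) :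
    P × C(Icc (0 : ℝ) 1, M) :=
  (x.1, x.2 - primitive (W.comp (constProdCurve x)))

theorem contDiff_integralDefect (W : C(P × M, M)) (hW : ContDiff ℝ ∞ W) :
    ContDiff ℝ ∞ (integralDefect W) :=
  contDiff_fst.prodMk (contDiff_snd.sub (primitive.contDiff.comp
    ((contDiff_postcomp W hW).comp constProdCurve.contDiff)))

/-- The derivative of `integralDefect`. -/
noncomputable def integralDefectDeriv (W' : C(P × M, P × M →L[ℝ] M))
    (x : P × C(Icc (0 : ℝ) 1, M)) :
    P × C(Icc (0 : ℝ) 1, M) →L[ℝ] P × C(Icc (0 : ℝ) 1, M) :=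
  (ContinuousLinearMap.fst ℝ _ _).prod (ContinuousLinearMap.snd ℝ _ _ -
    primitive ∘L pointwiseApply (W'.comp (constProdCurve x)) ∘L constProdCurve)

theorem hasFDerivAt_integralDefect (W : C(P × M, M)) (W' : C(P × M, P × M →L[ℝ] M))
    (hW : ∀ x, HasFDerivAt W (W' x) x) (x : P × C(Icc (0 : ℝ) 1, M)) :
    HasFDerivAt (integralDefect W) (integralDefectDeriv W' x) x := by
  have h1 : HasFDerivAt (fun x => W.comp (constProdCurve x))
      (pointwiseApply (W'.comp (constProdCurve x)) ∘L constProdCurve) x :=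
    (hasFDerivAt_postcomp W W' hW (constProdCurve x)).comp x
      (constProdCurve (P := P) (M := M)).hasFDerivAt
  have h2 := primitive.hasFDerivAt.comp x h1
  exact hasFDerivAt_fst.prodMk (hasFDerivAt_snd.sub h2)

/-- The shear `(c, γ) ↦ (c, γ - N c)`. -/
noncomputable def shearEquiv {P G : Type*} [NormedAddCommGroup P] [NormedSpace ℝ P]
    [NormedAddCommGroup G] [NormedSpace ℝ G] (N : P →L[ℝ] G) : (P × G) ≃L[ℝ] (P × G) :=
  ContinuousLinearEquiv.equivOfInverse
    ((ContinuousLinearMap.fst ℝ P G).prod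
      (ContinuousLinearMap.snd ℝ P G - N ∘L ContinuousLinearMap.fst ℝ P G))
    ((ContinuousLinearMap.fst ℝ P G).prod
      (ContinuousLinearMap.snd ℝ P G + N ∘L ContinuousLinearMap.fst ℝ P G))
    (fun x => by simp) (fun x => by simp)

theorem hasFDerivAt_clm_pairing {V : M → P →L[ℝ] M} {x : P × M} (hV : DifferentiableAt ℝ V x.2) :
    HasFDerivAt (fun x : P × M => V x.2 x.1)
      (V x.2 ∘L ContinuousLinearMap.fst ℝ P M +
        (fderiv ℝ V x.2 ∘L ContinuousLinearMap.snd ℝ P M).flip x.1) x :=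
  (hV.hasFDerivAt.comp x hasFDerivAt_snd).clm_apply hasFDerivAt_fst

/-- Along an integral curve `γ` of `V(·) c`, the variation `τ V(γ(τ)) d` solves the linearized
equation. -/
theorem integralDefectDeriv_variation [CompleteSpace M] {V : M → P →L[ℝ] M}
    (hV : ContDiff ℝ ∞ V)
    (W : C(P × M, M)) (hW : ∀ x, W x = V x.2 x.1) (W' : C(P × M, P × M →L[ℝ] M))
    (hW' : ∀ x, HasFDerivAt W (W' x) x) (c d : P) (q : M) (γ : C(Icc (0 : ℝ) 1, M))
    (hγ : integralDefect W (c, γ) = (c, ContinuousMap.const _ q))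
    (hi : ∀ τ, IsIntegrableAt V (γ τ)) :
    integralDefectDeriv W' (c, γ)
      (d, ⟨fun τ => (τ : ℝ) • V (γ τ) d, by
        have := hV.continuous
        fun_prop⟩) = (d, (0 : C(Icc (0 : ℝ) 1, M))) := by
  have hVd : Differentiable ℝ V := hV.differentiable (by simp)
  set w : C(Icc (0 : ℝ) 1, M) := W.comp (constProdCurve (c, γ)) with hw
  set γ' : ℝ → M := fun s => q + ∫ τ in (0 : ℝ)..s, IccExtend zero_le_one w τ with hγ'
  have hγ2 : γ - primitive w = ContinuousMap.const _ q := congrArg Prod.snd hγ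
  have e1 : ∀ s (hs : s ∈ Icc (0 : ℝ) 1), γ' s = γ ⟨s, hs⟩ := fun s hs => by
    have := DFunLike.congr_fun hγ2 ⟨s, hs⟩
    simp only [ContinuousMap.sub_apply, ContinuousMap.const_apply, primitive_apply] at this
    simp only [hγ']
    rw [← this]
    abel
  have e2 : ∀ s (hs : s ∈ Icc (0 : ℝ) 1), HasDerivAt γ' (V (γ ⟨s, hs⟩) c) s := fun s hs => by
    have := (hasDerivAt_integral_IccExtend w s).const_add q
    rwa [IccExtend_of_mem _ _ hs, hw, ContinuousMap.comp_apply, constProdCurve_apply, hW] at this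
  have hW'' : ∀ (x : P × M) (y : P × M), W' x y = V x.2 y.1 + fderiv ℝ V x.2 y.2 x.1 :=
    fun x y => by
      have h1 := hW' x
      rw [show (W : P × M → M) = fun x => V x.2 x.1 from funext hW] at h1
      rw [h1.unique (hasFDerivAt_clm_pairing (hVd x.2))]
      simp
  refine Prod.ext rfl ?_
  change _ - primitive _ = (0 : C(Icc (0 : ℝ) 1, M))
  rw [sub_eq_zero, eq_comm]
  -- The derivative of `s • V(γ) d` is `V(γ) d + s • DV(γ)(V(γ) c) d`. Integrability exchanges `c`
  -- and `d` in the last term, which gives the linearized right-hand side.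
  refine primitive_eq_of_hasDerivAt (g := fun s => s • V (γ' s) d) _ _ (fun s hs => ?_)
    (fun τ => ?_)
  · have h1 : HasDerivAt (fun s => V (γ' s) d) (fderiv ℝ V (γ ⟨s, hs⟩) (V (γ ⟨s, hs⟩) c) d) s := by
      have := ((hVd (γ' s)).hasFDerivAt.comp_hasDerivAt s (e2 s hs)).clm_apply (hasDerivAt_const s d)
      rw [e1 s hs] at this
      simpa using this
    have h2 := (hasDerivAt_id s).smul h1
    convert h2 using 1
    · rfl
    · simp [hW'', e1 s hs, hi ⟨s, hs⟩ c d, add_comm]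
  · simp [e1 τ τ.2]

/-- **Frobenius theorem** for total differential equations, local form. -/
theorem exists_frobenius [CompleteSpace P] [CompleteSpace M] (V : M → P →L[ℝ] M)
    (hV : ContDiff ℝ ∞ V) (q₀ : M) (hi : ∀ᶠ q in 𝓝 q₀, IsIntegrableAt V q) :
    ∃ Θ : P × M → M, ∀ᶠ x in 𝓝 ((0 : P), q₀), ContDiffAt ℝ ∞ Θ x ∧
      HasFDerivAt (fun c => Θ (c, x.2)) (V (Θ x)) x.1 ∧ Θ (0, x.2) = x.2 := by
  have hVW : ContDiff ℝ ∞ (fun x : P × M => V x.2 x.1) :=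
    (hV.comp contDiff_snd).clm_apply contDiff_fst
  let W : C(P × M, M) := ⟨fun x => V x.2 x.1, hVW.continuous⟩
  let W' : C(P × M, P × M →L[ℝ] M) := ⟨fderiv ℝ W, hVW.continuous_fderiv (by simp)⟩
  have hW' : ∀ x, HasFDerivAt W (W' x) x := fun x =>
    (hVW.differentiable (by simp) x).hasFDerivAt
  have hWW' : ∀ x y : P × M, W' x y = V x.2 y.1 + fderiv ℝ V x.2 y.2 x.1 := fun x y => by
    rw [(hW' x).unique (hasFDerivAt_clm_pairing (hV.differentiable (by simp) x.2))]
    simp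
  let x₀ : P × C(Icc (0 : ℝ) 1, M) := (0, ContinuousMap.const _ q₀)
  let N : P →L[ℝ] C(Icc (0 : ℝ) 1, M) :=
    primitive ∘L pointwiseApply (W'.comp (constProdCurve x₀)) ∘L constProdCurve ∘L
      ContinuousLinearMap.inl ℝ P C(Icc (0 : ℝ) 1, M)
  have hS : ContDiff ℝ ∞ (integralDefect W) := contDiff_integralDefect W hVW
  -- At `c = 0` the field `V(·) c` vanishes, so its derivative in the curve direction is zero and
  -- only the dependence on `c` remains: a shear, hence invertible.
  have hF : HasFDerivAt (integralDefect W) (shearEquiv N : _ →L[ℝ] _) x₀ := by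
    convert hasFDerivAt_integralDefect W W' hW' x₀ using 1
    refine ContinuousLinearMap.ext fun y => ?_
    refine Prod.ext rfl ?_
    change _ - primitive (_ : C(Icc (0 : ℝ) 1, M)) = _ - primitive (_ : C(Icc (0 : ℝ) 1, M))
    congr 2
    ext τ
    simp [hWW', x₀]
  have hfix : ∀ q : M, integralDefect W (0, ContinuousMap.const _ q) =
      (0, ContinuousMap.const _ q) := fun q => by
    have : W.comp (constProdCurve ((0 : P), ContinuousMap.const (Icc (0 : ℝ) 1) q)) = 0 := by
      ext τ
      simp [W]
    simp [integralDefect, this]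
  have h0 : (∞ : ℕ∞ω) ≠ 0 := by simp
  let H := hS.contDiffAt.toOpenPartialHomeomorph (integralDefect W) hF h0
  have hx₀ : x₀ ∈ H.source := hS.contDiffAt.mem_toOpenPartialHomeomorph_source hF h0
  let i : P × M →L[ℝ] P × C(Icc (0 : ℝ) 1, M) :=
    (ContinuousLinearMap.fst ℝ P M).prod (ContinuousLinearMap.const ℝ _ ∘L
      ContinuousLinearMap.snd ℝ P M)
  have hHx₀ : H x₀ = i (0, q₀) := hfix q₀
  have hsymm : H.symm (i (0, q₀)) = x₀ := by rw [← hHx₀, H.left_inv hx₀]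
  -- The inverse is differentiable only where the derivative is invertible, which is needed at all
  -- nearby points.
  have ev1 : ∀ᶠ x in 𝓝 x₀, ∃ e : (P × C(Icc (0 : ℝ) 1, M)) ≃L[ℝ] (P × C(Icc (0 : ℝ) 1, M)),
      HasFDerivAt (integralDefect W) (e : _ →L[ℝ] _) x := by
    have h1 : ContinuousAt (fderiv ℝ (integralDefect W)) x₀ :=
      (hS.continuous_fderiv h0).continuousAt
    have h2 := h1.eventually (by rw [hF.fderiv]; exact (shearEquiv N).nhds)
    filter_upwards [h2] with x ⟨e, he⟩
    exact ⟨e, he ▸ (hS.differentiable h0 x).hasFDerivAt⟩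
  have ev2 : ∀ᶠ x in 𝓝 x₀, ∀ τ, IsIntegrableAt V (x.2 τ) := by
    obtain ⟨r, hr, hb⟩ := Metric.eventually_nhds_iff.1 hi
    filter_upwards [continuous_snd.continuousAt.eventually (Metric.ball_mem_nhds x₀.2 hr)]
      with x hx τ
    exact hb ((ContinuousMap.dist_apply_le_dist τ).trans_lt hx)
  have hc : ContinuousAt (fun y => H.symm (i y)) ((0 : P), q₀) :=
    ContinuousAt.comp (H.continuousAt_symm (hHx₀ ▸ H.map_source hx₀)) i.continuous.continuousAt
  have ev3 := ev1.and ev2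
  rw [← hsymm] at ev3
  replace ev3 := hc.eventually ev3
  have ev4 : ∀ᶠ y in 𝓝 ((0 : P), q₀), i y ∈ H.target :=
    i.continuous.continuousAt.eventually (H.open_target.mem_nhds (hHx₀ ▸ H.map_source hx₀))
  have ev5 : ∀ᶠ y in 𝓝 ((0 : P), q₀), i (0, y.2) ∈ H.source :=
    (i.continuous.comp (continuous_const.prodMk continuous_snd)).continuousAt.eventually
      (H.open_source.mem_nhds hx₀)
  -- `Θ (c, q)` is the endpoint at `τ = 1` of the integral curve of `V(·) c` from `q`. The variation
  -- `τ V(γ(τ)) d`, evaluated there, gives the derivative `V(Θ) d`.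
  let ev : P × C(Icc (0 : ℝ) 1, M) →L[ℝ] M :=
    ContinuousMap.evalCLM ℝ (⟨1, by simp⟩ : Icc (0 : ℝ) 1) ∘L ContinuousLinearMap.snd ℝ _ _
  refine ⟨fun y => ev (H.symm (i y)), ?_⟩
  filter_upwards [ev3, ev4, ev5] with y ⟨⟨e, he⟩, hint⟩ htar hsrc
  have hHs : integralDefect W (H.symm (i y)) = i y := H.right_inv htar
  refine ⟨?_, ?_, ?_⟩
  · exact ev.contDiff.contDiffAt.comp y ((H.contDiffAt_symm htar he hS.contDiffAt).comp y
      i.contDiff.contDiffAt)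
  · have hd : HasFDerivAt (fun c : P => ev (H.symm (i (c, y.2))))
        (ev ∘L (e.symm : _ →L[ℝ] _) ∘L i ∘L ContinuousLinearMap.inl ℝ P M) y.1 := by
      refine ev.hasFDerivAt.comp y.1 (HasFDerivAt.comp y.1 (g := H.symm) ?_ ?_)
      · exact H.hasFDerivAt_symm htar he
      · exact i.hasFDerivAt.comp y.1 (hasFDerivAt_prodMk_left y.1 y.2)
    convert hd using 1
    ext d
    set x := H.symm (i y) with hx
    have hx1 : x.1 = y.1 := congrArg Prod.fst hHs
    have hxe : (y.1, x.2) = x := Prod.ext hx1.symm rfl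
    have hvar := integralDefectDeriv_variation hV W (fun _ => rfl) W' hW' y.1 d y.2 x.2
      (by rw [hxe]; exact hHs) hint
    rw [hxe, (hasFDerivAt_integralDefect W W' hW' x).unique he] at hvar
    have h3 := (e.eq_symm_apply).2 hvar
    have h4 : i (d, (0 : M)) = (d, 0) := rfl
    simp only [ContinuousLinearMap.comp_apply, ContinuousLinearMap.inl_apply, h4,
      ContinuousLinearEquiv.coe_coe]
    rw [← h3]
    simp [ev]
  · have h5 : H (i (0, y.2)) = i (0, y.2) := hfix y.2
    have h6 : H.symm (i (0, y.2)) = i (0, y.2) := by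
      conv_lhs => rw [← h5]
      exact H.left_inv hsrc
    change ev (H.symm (i (0, y.2))) = y.2
    rw [h6]
    rfl

/-- Uniqueness of integral curves on the unit interval. -/
theorem integralCurve_unique [FiniteDimensional ℝ M] (f : M → M) (hf : ContDiff ℝ 1 f)
    {g₁ g₂ : ℝ → M}
    (h₁ : ∀ τ ∈ Icc (0 : ℝ) 1, HasDerivAt g₁ (f (g₁ τ)) τ)
    (h₂ : ∀ τ ∈ Icc (0 : ℝ) 1, HasDerivAt g₂ (f (g₂ τ)) τ) {τ₀ : ℝ} (hτ₀ : τ₀ = 0 ∨ τ₀ = 1)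
    (h : g₁ τ₀ = g₂ τ₀) : EqOn g₁ g₂ (Icc 0 1) := by
  have c₁ : ContinuousOn g₁ (Icc 0 1) := HasDerivAt.continuousOn h₁
  have c₂ : ContinuousOn g₂ (Icc 0 1) := HasDerivAt.continuousOn h₂
  obtain ⟨R, hR⟩ := (((isCompact_Icc.image_of_continuousOn c₁).union
    (isCompact_Icc.image_of_continuousOn c₂)).isBounded).subset_closedBall (0 : M)
  obtain ⟨C, hC⟩ := (isCompact_closedBall (0 : M) R).exists_bound_of_continuousOn
    (hf.continuous_fderiv one_ne_zero).continuousOn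
  have hL : LipschitzOnWith C.toNNReal f (Metric.closedBall 0 R) :=
    (convex_closedBall (0 : M) R).lipschitzOnWith_of_nnnorm_fderiv_le
      (fun x _ => hf.differentiable one_ne_zero x) fun x hx => by
        rw [← NNReal.coe_le_coe, coe_nnnorm]
        exact (hC x hx).trans (Real.le_coe_toNNReal C)
  have m₁ : ∀ τ ∈ Icc (0 : ℝ) 1, g₁ τ ∈ Metric.closedBall (0 : M) R :=
    fun τ hτ => hR (Or.inl (mem_image_of_mem _ hτ))
  have m₂ : ∀ τ ∈ Icc (0 : ℝ) 1, g₂ τ ∈ Metric.closedBall (0 : M) R :=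
    fun τ hτ => hR (Or.inr (mem_image_of_mem _ hτ))
  rcases hτ₀ with rfl | rfl
  · exact ODE_solution_unique_of_mem_Icc_right (v := fun _ => f)
      (s := fun _ => Metric.closedBall 0 R) (fun _ _ => hL) c₁
      (fun t ht => (h₁ t (Ico_subset_Icc_self ht)).hasDerivWithinAt)
      (fun t ht => m₁ t (Ico_subset_Icc_self ht)) c₂
      (fun t ht => (h₂ t (Ico_subset_Icc_self ht)).hasDerivWithinAt)
      (fun t ht => m₂ t (Ico_subset_Icc_self ht)) h
  · exact ODE_solution_unique_of_mem_Icc_left (v := fun _ => f)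
      (s := fun _ => Metric.closedBall 0 R) (fun _ _ => hL) c₁
      (fun t ht => (h₁ t (Ioc_subset_Icc_self ht)).hasDerivWithinAt)
      (fun t ht => m₁ t (Ioc_subset_Icc_self ht)) c₂
      (fun t ht => (h₂ t (Ioc_subset_Icc_self ht)).hasDerivWithinAt)
      (fun t ht => m₂ t (Ioc_subset_Icc_self ht)) h

end TotalDifferentialEquation

/-! ### Local flows with uniform domains. -/

section LocalFlow

universe u

variable {P M : Type u} [NormedAddCommGroup P] [NormedSpace ℝ P]
  [NormedAddCommGroup M] [NormedSpace ℝ M]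

/-- Rays in the parameter space give integral curves. -/
theorem hasDerivAt_ray {V : M → P →L[ℝ] M} {Θ : P × M → M} {c : P} {q : M} {s : ℝ}
    (h : HasFDerivAt (fun c => Θ (c, q)) (V (Θ (s • c, q))) (s • c)) :
    HasDerivAt (fun s : ℝ => Θ (s • c, q)) (V (Θ (s • c, q)) c) s := by
  have h1 : HasDerivAt (fun s : ℝ => s • c) c s := by
    simpa using (hasDerivAt_id s).smul_const c
  exact HasFDerivAt.comp_hasDerivAt (f := fun s : ℝ => s • c) s h h1

theorem norm_smul_lt_of_mem_Icc {c : P} {ε s : ℝ} (hc : ‖c‖ < ε) (hs : s ∈ Icc (0 : ℝ) 1) :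
    ‖s • c‖ < ε := by
  rw [norm_smul, Real.norm_of_nonneg hs.1]
  exact (mul_le_of_le_one_left (norm_nonneg c) hs.2).trans_lt hc

/-- The inversion formula compares the ray `s ↦ Θ (s • c, q)` with the ray for `-c` from its
endpoint, run backwards. Both solve the same equation and agree at `s = 1`, hence at `s = 0`. -/
theorem exists_local_flow [CompleteSpace P] [FiniteDimensional ℝ M] (V : M → P →L[ℝ] M)
    (hV : ContDiff ℝ ∞ V) (q₀ : M) (hi : ∀ᶠ q in 𝓝 q₀, IsIntegrableAt V q) {N : Set M}
    (hN : N ∈ 𝓝 q₀) :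
    ∃ Θ : P × M → M, ∃ ε > 0, ∀ c, ‖c‖ < ε → ∀ q ∈ Metric.ball q₀ ε,
      ContDiffAt ℝ ∞ Θ (c, q) ∧ HasFDerivAt (fun c => Θ (c, q)) (V (Θ (c, q))) c ∧
      Θ (0, q) = q ∧ Θ (c, q) ∈ N ∧ Θ (-c, Θ (c, q)) = q := by
  have := FiniteDimensional.complete ℝ M
  obtain ⟨Θ, hΘ⟩ := exists_frobenius V hV q₀ hi
  have ball_of_nhds : ∀ {p : P × M → Prop}, (∀ᶠ x in 𝓝 ((0 : P), q₀), p x) →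
      ∃ ε > 0, ∀ c, ‖c‖ < ε → ∀ q ∈ Metric.ball q₀ ε, p (c, q) := fun {p} hp => by
    obtain ⟨ε, hε, h⟩ := Metric.eventually_nhds_iff_ball.1 hp
    refine ⟨ε, hε, fun c hc q hq => h _ ?_⟩
    rw [← ball_prod_same]
    exact ⟨by simpa using hc, hq⟩
  obtain ⟨ε, hε, h⟩ := ball_of_nhds hΘ
  have h0 := hΘ.self_of_nhds
  have hc : ContinuousAt Θ (0, q₀) := h0.1.continuousAt
  obtain ⟨δ, hδ, h'⟩ := ball_of_nhds (hc.eventually (p := fun q => q ∈ N ∩ Metric.ball q₀ ε)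
    (by rw [h0.2.2]; exact inter_mem hN (Metric.ball_mem_nhds _ hε)))
  refine ⟨Θ, min ε δ, lt_min hε hδ, fun c hc q hq => ?_⟩
  have hcε := hc.trans_le (min_le_left _ _)
  have hqε := Metric.ball_subset_ball (min_le_left _ _) hq
  obtain ⟨h1, h2, h3⟩ := h c hcε q hqε
  obtain ⟨h4, h5⟩ := h' c (hc.trans_le (min_le_right _ _)) q
    (Metric.ball_subset_ball (min_le_right _ _) hq)
  refine ⟨h1, h2, h3, h4, ?_⟩
  have hf : ContDiff ℝ 1 (fun x => V x c) :=
    (hV.of_le (by exact_mod_cast le_top)).clm_apply contDiff_const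
  have hneg : ‖-c‖ < ε := by rwa [norm_neg]
  have hE := integralCurve_unique (fun x => V x c) hf
    (g₁ := fun s : ℝ => Θ (s • c, q)) (g₂ := fun s : ℝ => Θ ((1 - s) • (-c), Θ (c, q)))
    (fun s hs => hasDerivAt_ray (h _ (norm_smul_lt_of_mem_Icc hcε hs) q hqε).2.1)
    (fun s hs => by
      have hs' : 1 - s ∈ Icc (0 : ℝ) 1 := ⟨by linarith [hs.2], by linarith [hs.1]⟩
      have := (hasDerivAt_ray (h _ (norm_smul_lt_of_mem_Icc hneg hs') _ h5).2.1).scomp s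
        ((hasDerivAt_id s).const_sub 1)
      simpa [Function.comp_def] using this)
    (Or.inr rfl) (by simp [(h c hcε _ h5).2.2])
  have := hE (left_mem_Icc.2 zero_le_one)
  simp only [zero_smul, sub_zero, one_smul] at this
  rw [← this, h3]

end LocalFlow

/-! ### Transport along the leaves from a transversal. -/

section Transversal

universe u

variable {P B E : Type u} [NormedAddCommGroup P] [NormedSpace ℝ P] [CompleteSpace P]
  [NormedAddCommGroup B] [NormedSpace ℝ B] [FiniteDimensional ℝ B]
  [NormedAddCommGroup E] [NormedSpace ℝ E] [FiniteDimensional ℝ E]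

/-- Along the leaves of an integrable distribution on `B × E` that projects isomorphically to a
distribution on `B`, points of `E` are transported smoothly from a transversal through `b₀`. -/
theorem exists_leaf_transport (VB : B → P →L[ℝ] B) (hVB : ContDiff ℝ ∞ VB)
    (VE : B × E → P →L[ℝ] E) (hVE : ContDiff ℝ ∞ VE) (u : B →L[ℝ] P) (b₀ : B)
    (hu : ∀ᶠ b in 𝓝 b₀, ∀ c, u (VB b c) = c)
    (hiB : ∀ᶠ b in 𝓝 b₀, IsIntegrableAt VB b)
    (hi : ∀ᶠ b in 𝓝 b₀, ∀ y, IsIntegrableAt (fun q : B × E => (VB q.1).prod (VE q)) (b, y))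
    {N : Set B} (hN : N ∈ 𝓝 b₀) :
    ∃ (Ω : Set (B × E)) (Φ : B × E → E), IsOpen Ω ∧ (∀ k, (b₀, k) ∈ Ω ∧ Φ (b₀, k) = k) ∧
      (∀ q ∈ Ω, q.1 ∈ N) ∧ (∀ q ∈ Ω, ContDiffAt ℝ ∞ Φ q) ∧
      (∀ b k k', (b, k) ∈ Ω → (b, k') ∈ Ω → Φ (b, k) = Φ (b, k') → k = k') ∧
      (∀ q ∈ Ω, Function.Bijective (fderiv ℝ (fun k => Φ (q.1, k)) q.2)) ∧
      ∀ q ∈ Ω, ∀ d, fderiv ℝ Φ q (VB q.1 d, 0) = VE (q.1, Φ q) d := by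
  classical
  set V : B × E → P →L[ℝ] B × E := fun q => (VB q.1).prod (VE q) with hVdef
  have hV : ContDiff ℝ ∞ V := by
    have h1 : V = fun q => ContinuousLinearMap.inl ℝ B E ∘L VB q.1 +
        ContinuousLinearMap.inr ℝ B E ∘L VE q := by
      ext q c <;> simp [hVdef]
    rw [h1]
    exact (contDiff_const.clm_comp (hVB.comp contDiff_fst)).add (contDiff_const.clm_comp hVE)
  have hV1 : ∀ c, ContDiff ℝ 1 (fun x => V x c) := fun c =>
    (hV.of_le (by exact_mod_cast le_top)).clm_apply contDiff_const
  have hVB1 : ∀ c, ContDiff ℝ 1 (fun x => VB x c) := fun c =>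
    (hVB.of_le (by exact_mod_cast le_top)).clm_apply contDiff_const
  -- Passing `hu` as the target neighbourhood keeps the flow where `u` is a left inverse of `VB`;
  -- there `u` is a flow coordinate.
  obtain ⟨θ, ε, hε, hθ⟩ := exists_local_flow VB hVB b₀ hiB hu
  have hθu : ∀ c, ‖c‖ < ε → ∀ b ∈ Metric.ball b₀ ε, u (θ (c, b)) = u b + c := by
    intro c hc b hb
    have hd : ∀ s ∈ Icc (0 : ℝ) 1, HasDerivAt (fun s : ℝ => u (θ (s • c, b)) - s • c) 0 s := by
      intro s hs
      obtain ⟨-, h2, -, h4, -⟩ := hθ _ (norm_smul_lt_of_mem_Icc hc hs) b hb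
      have h5 := (u.hasFDerivAt.comp_hasDerivAt s (hasDerivAt_ray h2)).sub
        ((hasDerivAt_id s).smul_const c)
      rw [h4] at h5
      simpa [sub_self] using (show HasDerivAt (fun s : ℝ => u (θ (s • c, b)) - s • c) _ s from h5)
    have := constant_of_has_deriv_right_zero (HasDerivAt.continuousOn hd)
      (fun s hs => (hd s (Ico_subset_Icc_self hs)).hasDerivWithinAt) 1 (right_mem_Icc.2 zero_le_one)
    simp only [one_smul, zero_smul, sub_zero] at this
    rw [(hθ c hc b hb).2.2.1] at this
    rw [← this]
    abel
  -- `cc b` is the parameter leading to `b` from the slice `u = u b₀`, and `σ b` is the starting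
  -- point on that slice.
  set cc : B → P := fun b => u b - u b₀ with hcc
  set σ : B → B := fun b => θ (-cc b, b) with hσ
  have hcc0 : cc b₀ = 0 := sub_self _
  have hccs : ContDiff ℝ ∞ cc := u.contDiff.sub contDiff_const
  have hθ0 := hθ 0 (by simpa using hε) b₀ (Metric.mem_ball_self hε)
  have hσ0 : σ b₀ = b₀ := by simp only [hσ, hcc0, neg_zero]; exact hθ0.2.2.1
  have hσat : ∀ b, ‖cc b‖ < ε → b ∈ Metric.ball b₀ ε → ContDiffAt ℝ ∞ σ b := fun b h1 h2 =>
    ContDiffAt.comp b (g := θ) (f := fun b => (-cc b, b)) (hθ _ (by rwa [norm_neg]) b h2).1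
      (hccs.neg.prodMk contDiff_id).contDiffAt
  have hσc : ContinuousAt σ b₀ :=
    (hσat b₀ (by rw [hcc0]; simpa using hε) (Metric.mem_ball_self hε)).continuousAt
  -- base points at which all data are defined
  let D : B → Prop := fun b => ‖cc b‖ < ε ∧ b ∈ Metric.ball b₀ ε ∧ σ b ∈ Metric.ball b₀ ε
  have hD : ∀ᶠ b in 𝓝 b₀, D b :=
    (hccs.continuous.norm.continuousAt.eventually (gt_mem_nhds (by simpa [hcc0] using hε))).and
      ((show ∀ᶠ b in 𝓝 b₀, b ∈ Metric.ball b₀ ε from Metric.ball_mem_nhds b₀ hε).and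
        (hσc.eventually (p := fun b => b ∈ Metric.ball b₀ ε)
          (by rw [hσ0]; exact Metric.ball_mem_nhds _ hε)))
  have hret : ∀ b, D b → θ (cc b, σ b) = b := fun b hb => by
    have := (hθ (-cc b) (by rw [norm_neg]; exact hb.1) b hb.2.1).2.2.2.2
    rwa [neg_neg] at this
  have huσ : ∀ b, D b → u (σ b) = u b₀ := fun b hb => by
    rw [hσ]
    simp only
    rw [hθu _ (by rw [norm_neg]; exact hb.1) b hb.2.1, hcc, neg_sub, add_sub_cancel]
  have hccθ : ∀ b, D b → ∀ c, ‖c‖ < ε → cc (θ (c, σ b)) = c := fun b hb c hc => by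
    rw [hcc]
    simp only
    rw [hθu c hc _ hb.2.2, huσ b hb]
    abel
  have hσθ : ∀ b, D b → ∀ c, ‖c‖ < ε → σ (θ (c, σ b)) = σ b := fun b hb c hc => by
    change θ (-cc (θ (c, σ b)), θ (c, σ b)) = σ b
    rw [hccθ b hb c hc]
    exact (hθ c hc _ hb.2.2).2.2.2.2
  -- The lifted curve over the path from `σ b` to `b` takes `k` to `y`. ODE uniqueness in both
  -- directions makes this a partial injection that does not refer to a local flow, so `Φ` is well
  -- defined although the radius `δ` below depends on `k₀`.
  let Sol : B → E → E → Prop := fun b k y => ∃ g : ℝ → B × E,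
    (∀ s ∈ Icc (0 : ℝ) 1, HasDerivAt g (V (g s) (cc b)) s) ∧ g 0 = (σ b, k) ∧ g 1 = (b, y)
  have hSol₁ : ∀ {b k y y'}, Sol b k y → Sol b k y' → y = y' := by
    rintro b k y y' ⟨g, h1, h2, h3⟩ ⟨g', h1', h2', h3'⟩
    have := integralCurve_unique (fun x => V x (cc b)) (hV1 _) h1 h1' (Or.inl rfl)
      (h2.trans h2'.symm) (right_mem_Icc.2 zero_le_one)
    rw [h3, h3'] at this
    exact congrArg Prod.snd this
  have hSol₂ : ∀ {b k k' y}, Sol b k y → Sol b k' y → k = k' := by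
    rintro b k k' y ⟨g, h1, h2, h3⟩ ⟨g', h1', h2', h3'⟩
    have := integralCurve_unique (fun x => V x (cc b)) (hV1 _) h1 h1' (Or.inr rfl)
      (h3.trans h3'.symm) (left_mem_Icc.2 zero_le_one)
    rw [h2, h2'] at this
    exact congrArg Prod.snd this
  let Φ : B × E → E := fun q => Classical.epsilon (Sol q.1 q.2)
  have hΦ : ∀ {b k y}, Sol b k y → Φ (b, k) = y := fun {b k y} h =>
    hSol₁ (Classical.epsilon_spec (p := Sol b k) ⟨y, h⟩) h
  let Good : B × E → Prop := fun q => q.1 ∈ N ∧ ContDiffAt ℝ ∞ Φ q ∧ Sol q.1 q.2 (Φ q) ∧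
    Function.Bijective (fderiv ℝ (fun k => Φ (q.1, k)) q.2) ∧
    ∀ d, fderiv ℝ Φ q (VB q.1 d, 0) = VE (q.1, Φ q) d
  have local_formula : ∀ k₀ : E, ∃ (Θ : P × (B × E) → B × E) (δ : ℝ), 0 < δ ∧
      (∀ c, ‖c‖ < δ → ∀ q ∈ Metric.ball (b₀, k₀) δ, ContDiffAt ℝ ∞ Θ (c, q) ∧
        HasFDerivAt (fun c => Θ (c, q)) (V (Θ (c, q))) c ∧ Θ (0, q) = q) ∧
      ∀ᶠ q in 𝓝 (b₀, k₀), D q.1 ∧ ‖cc q.1‖ < δ ∧ (σ q.1, q.2) ∈ Metric.ball (b₀, k₀) δ ∧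
        Sol q.1 q.2 (Φ q) ∧ Θ (cc q.1, (σ q.1, q.2)) = (q.1, Φ q) := by
    intro k₀
    obtain ⟨Θ, δ, hδ, hΘ⟩ := exists_local_flow V hV (b₀, k₀)
      (continuous_fst.continuousAt.eventually (p := fun b => ∀ y, IsIntegrableAt V (b, y)) hi |>.mono
        fun q hq => hq q.2) univ_mem
    refine ⟨Θ, δ, hδ, fun c hc q hq => ⟨(hΘ c hc q hq).1, (hΘ c hc q hq).2.1,
      (hΘ c hc q hq).2.2.1⟩, ?_⟩
    have e1 : ∀ᶠ q : B × E in 𝓝 (b₀, k₀), D q.1 := continuous_fst.continuousAt.eventually hD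
    have e2 : ∀ᶠ q : B × E in 𝓝 (b₀, k₀), ‖cc q.1‖ < δ :=
      (hccs.continuous.comp continuous_fst).norm.continuousAt.eventually
        (gt_mem_nhds (by simpa [hcc0] using hδ))
    have e3 : ∀ᶠ q : B × E in 𝓝 (b₀, k₀), (σ q.1, q.2) ∈ Metric.ball (b₀, k₀) δ := by
      have : ContinuousAt (fun q : B × E => (σ q.1, q.2)) (b₀, k₀) :=
        (ContinuousAt.comp (x := (b₀, k₀)) (g := σ) hσc continuousAt_fst).prodMk continuousAt_snd
      exact this.eventually (p := fun q => q ∈ Metric.ball (b₀, k₀) δ)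
        (by simp only [hσ0]; exact Metric.ball_mem_nhds _ hδ)
    filter_upwards [e1, e2, e3] with q h1 h2 h3
    obtain ⟨b, k⟩ := q
    have hray : ∀ s ∈ Icc (0 : ℝ) 1, HasDerivAt (fun s : ℝ => Θ (s • cc b, (σ b, k)))
        (V (Θ (s • cc b, (σ b, k))) (cc b)) s := fun s hs =>
      hasDerivAt_ray (hΘ _ (norm_smul_lt_of_mem_Icc h2 hs) _ h3).2.1
    have hΘ0 : Θ (0, (σ b, k)) = (σ b, k) := (hΘ _ h2 _ h3).2.2.1
    -- The projection of a lifted curve to `B` solves the base equation, so it follows `θ` and ends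
    -- at `b`.
    have hb : (Θ (cc b, (σ b, k))).1 = b := by
      have := integralCurve_unique (fun x => VB x (cc b)) (hVB1 _)
        (g₁ := fun s : ℝ => (Θ (s • cc b, (σ b, k))).1) (g₂ := fun s : ℝ => θ (s • cc b, σ b))
        (fun s hs => HasFDerivAt.comp_hasDerivAt
          (f := fun s : ℝ => Θ (s • cc b, (σ b, k))) s hasFDerivAt_fst (hray s hs))
        (fun s hs => hasDerivAt_ray (hθ _ (norm_smul_lt_of_mem_Icc h1.1 hs) _ h1.2.2).2.1)
        (Or.inl rfl) (by simp [hΘ0, (hθ _ h1.1 _ h1.2.2).2.2.1]) (right_mem_Icc.2 zero_le_one)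
      simp only [one_smul] at this
      rw [this, hret b h1]
    have hs : Sol b k (Θ (cc b, (σ b, k))).2 :=
      ⟨fun s : ℝ => Θ (s • cc b, (σ b, k)), hray, by simp [hΘ0], by
        simp only [one_smul]; exact Prod.ext hb rfl⟩
    have hΦ' := hΦ hs
    exact ⟨h1, h2, h3, by rw [hΦ']; exact hs, Prod.ext hb hΦ'.symm⟩
  have hΦ0 : ∀ k, Φ (b₀, k) = k := fun k => by
    obtain ⟨Θ, δ, hδ, hΘ, hev⟩ := local_formula k
    obtain ⟨-, h2, h3, -, h⟩ := hev.self_of_nhds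
    simp only [hσ0, hcc0] at h h2 h3
    rw [(hΘ 0 h2 _ h3).2.2] at h
    exact (congrArg Prod.snd h).symm
  have hgood : ∀ k, ∀ᶠ q in 𝓝 (b₀, k), Good q := by
    intro k₀
    obtain ⟨Θ, δ, hδ, hΘ, hev⟩ := local_formula k₀
    have hsm : ∀ᶠ q in 𝓝 (b₀, k₀), ContDiffAt ℝ ∞ Φ q := by
      filter_upwards [hev.eventually_nhds] with q hq
      obtain ⟨h1, h2, h3, -, -⟩ := hq.self_of_nhds
      have hf : ContDiffAt ℝ ∞ (fun q : B × E => (Θ (cc q.1, (σ q.1, q.2))).2) q := by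
        refine contDiffAt_snd.comp q (ContDiffAt.comp q (g := Θ)
          (f := fun q : B × E => (cc q.1, (σ q.1, q.2))) (hΘ _ h2 _ h3).1 ?_)
        exact (hccs.contDiffAt.comp q contDiffAt_fst).prodMk
          (((hσat q.1 h1.1 h1.2.1).comp q contDiffAt_fst).prodMk contDiffAt_snd)
      refine hf.congr_of_eventuallyEq ?_
      filter_upwards [hq] with x hx
      rw [hx.2.2.2.2]
    have hfd : ∀ q : B × E, ContDiffAt ℝ ∞ Φ q → fderiv ℝ (fun k => Φ (q.1, k)) q.2 =
        fderiv ℝ Φ q ∘L ContinuousLinearMap.inr ℝ B E := fun q hq =>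
      HasFDerivAt.fderiv (HasFDerivAt.comp (g := Φ) q.2
        (hq.differentiableAt (by simp)).hasFDerivAt (hasFDerivAt_prodMk_right q.1 q.2))
    have hbij : ∀ᶠ q in 𝓝 (b₀, k₀),
        Function.Bijective (fderiv ℝ (fun k => Φ (q.1, k)) q.2) := by
      have hc : ContinuousAt (fun q => fderiv ℝ Φ q ∘L ContinuousLinearMap.inr ℝ B E) (b₀, k₀) :=
        ((hsm.self_of_nhds.fderiv_right (m := 0) (by simp)).continuousAt).clm_comp
          continuousAt_const
      have h0 : fderiv ℝ Φ (b₀, k₀) ∘L ContinuousLinearMap.inr ℝ B E =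
          (ContinuousLinearEquiv.refl ℝ E : E →L[ℝ] E) := by
        rw [← hfd _ hsm.self_of_nhds]
        simp only [hΦ0]
        exact fderiv_fun_id
      have h1 := (ContinuousLinearEquiv.refl ℝ E).nhds
      rw [← h0] at h1
      replace h1 := hc.eventually h1
      filter_upwards [h1, hsm] with q ⟨e, he⟩ hq
      rw [hfd q hq, ← he]
      exact e.bijective
    filter_upwards [hev.eventually_nhds, hsm, hbij,
      (continuousAt_fst (p := (b₀, k₀))).eventually (p := fun b => b ∈ N) hN]
      with q hq hs hb hNq
    obtain ⟨h1, h2, h3, h4, h5⟩ := hq.self_of_nhds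
    refine ⟨hNq, hs, h4, hb, fun d => ?_⟩
    obtain ⟨b, k⟩ := q
    have hθd := (hθ _ h1.1 _ h1.2.2).2.1
    rw [hret b h1] at hθd
    have hL : HasFDerivAt (fun c => Φ (θ (c, σ b), k))
        (fderiv ℝ Φ (b, k) ∘L (VB b).prod 0) (cc b) := by
      refine HasFDerivAt.comp (g := Φ) (f := fun c => (θ (c, σ b), k)) (cc b) ?_
        (hθd.prodMk (hasFDerivAt_const k _))
      simp only [hret b h1]
      exact (hs.differentiableAt (by simp)).hasFDerivAt
    have hR : HasFDerivAt (fun c => (Θ (c, (σ b, k))).2) (VE (b, Φ (b, k))) (cc b) := by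
      have := (hasFDerivAt_snd (𝕜 := ℝ)).comp (cc b) (hΘ _ h2 _ h3).2.1
      rw [h5] at this
      exact this
    -- On the base leaf `c ↦ θ (c, σ b)` the foot `σ` is constant and `cc` equals `c`, so `Φ` there
    -- is the `E`-component of `Θ`, whose derivative is `VE`.
    have hEq : (fun c => Φ (θ (c, σ b), k)) =ᶠ[𝓝 (cc b)] fun c => (Θ (c, (σ b, k))).2 := by
      have hcont : ContinuousAt (fun c => (θ (c, σ b), k)) (cc b) :=
        hθd.continuousAt.prodMk continuousAt_const
      have h6 : ∀ᶠ c in 𝓝 (cc b), ‖c‖ < ε :=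
        continuous_norm.continuousAt.eventually (gt_mem_nhds h1.1)
      rw [← hret b h1] at hq
      filter_upwards [hcont.eventually hq, h6] with c hc hcε
      have h7 := hc.2.2.2.2
      simp only [hccθ b h1 c hcε, hσθ b h1 c hcε] at h7
      rw [h7]
    have := DFunLike.congr_fun (hL.unique (hR.congr_of_eventuallyEq hEq)) d
    simpa using this
  refine ⟨{q | ∀ᶠ x in 𝓝 q, Good x}, Φ, isOpen_setOfPred_eventually_nhds,
    fun k => ⟨hgood k, hΦ0 k⟩, fun q hq => (Eventually.self_of_nhds hq).1,
    fun q hq => (Eventually.self_of_nhds hq).2.1, fun b k k' h h' he => ?_,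
    fun q hq => (Eventually.self_of_nhds hq).2.2.2.1,
    fun q hq => (Eventually.self_of_nhds hq).2.2.2.2⟩
  have h1 := (Eventually.self_of_nhds h).2.2.1
  have h2 := (Eventually.self_of_nhds h').2.2.1
  rw [← he] at h2
  exact hSol₂ h1 h2

end Transversal

/-! ### Separating points, complements of kernels, cut-off extensions. -/

section LinearAlgebra

/-- Finitely many members of a family of linear maps have the same common kernel on a
finite-dimensional subspace as the whole family. -/
theorem exists_separating_points {V W Y : Type*} [AddCommGroup V] [Module ℝ V]
    [FiniteDimensional ℝ V] [AddCommGroup W] [Module ℝ W] [Nonempty Y] (L : Y → V →ₗ[ℝ] W)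
    (d : ℕ) : ∀ K : Submodule ℝ V, Module.finrank ℝ K ≤ d →
      ∃ p : Fin d → Y, ∀ c ∈ K, (∀ i, L (p i) c = 0) → ∀ y, L y c = 0 := by
  induction d with
  | zero =>
    intro K hK
    have : K = ⊥ := Submodule.finrank_eq_zero.1 (Nat.le_zero.1 hK)
    subst this
    refine ⟨Fin.elim0, fun c hc _ y => ?_⟩
    rw [(Submodule.mem_bot ℝ).1 hc, map_zero]
  | succ d ih =>
    intro K hK
    by_cases h : ∀ c ∈ K, ∀ y, L y c = 0
    · exact ⟨fun _ => Classical.arbitrary Y, fun c hc _ => h c hc⟩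
    · push Not at h
      obtain ⟨c, hc, y, hy⟩ := h
      have hlt : K ⊓ LinearMap.ker (L y) < K :=
        lt_of_le_of_ne inf_le_left fun he => hy (by
          have : c ∈ K ⊓ LinearMap.ker (L y) := by rw [he]; exact hc
          exact this.2)
      obtain ⟨p, hp⟩ := ih _ (Nat.le_of_lt_succ ((Submodule.finrank_lt_finrank_of_lt hlt).trans_le hK))
      refine ⟨Fin.cons y p, fun c hc h => hp c ⟨hc, ?_⟩ fun i => ?_⟩
      · simpa using h 0
      · simpa using h i.succ

/-- A linear map has a left inverse on a complement of its kernel, and composing a perturbation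
with it bounds the dimension of the kernel of the perturbation. -/
theorem exists_leftInverse_on_complement {V F : Type*} [NormedAddCommGroup V] [NormedSpace ℝ V]
    [FiniteDimensional ℝ V] [NormedAddCommGroup F] [NormedSpace ℝ F] [FiniteDimensional ℝ F]
    (T₀ : V →L[ℝ] F) : ∃ (C : Submodule ℝ V) (π : F →L[ℝ] C),
      π ∘L T₀ ∘L C.subtypeL = ContinuousLinearMap.id ℝ C ∧
      ∀ T : V →L[ℝ] C, Function.Injective (T ∘L C.subtypeL) →
        Module.finrank ℝ (LinearMap.ker T.toLinearMap) ≤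
          Module.finrank ℝ (LinearMap.ker T₀.toLinearMap) := by
  obtain ⟨C, hC⟩ := (LinearMap.ker T₀.toLinearMap).exists_isCompl
  have hinj : LinearMap.ker (T₀.toLinearMap ∘ₗ C.subtype) = ⊥ := by
    rw [LinearMap.ker_comp, ← Submodule.disjoint_iff_comap_eq_bot]
    exact hC.symm.disjoint
  obtain ⟨g, hg⟩ := LinearMap.exists_leftInverse_of_injective _ hinj
  refine ⟨C, LinearMap.toContinuousLinearMap g, ?_, fun T hT => ?_⟩
  · ext c
    exact congrArg _ (LinearMap.congr_fun hg c)
  · have hd : LinearMap.ker T.toLinearMap ⊓ C = ⊥ := by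
      rw [eq_bot_iff]
      rintro x ⟨hx, hxC⟩
      have : (⟨x, hxC⟩ : C) = 0 := hT (by simpa using hx)
      simpa using congrArg Subtype.val this
    have h1 := Submodule.finrank_sup_add_finrank_inf_eq (LinearMap.ker T.toLinearMap) C
    rw [hd, finrank_bot, add_zero] at h1
    have h2 := Submodule.finrank_le (LinearMap.ker T.toLinearMap ⊔ C)
    have h3 := Submodule.finrank_add_eq_of_isCompl hC
    omega

/-- A map that is smooth near a point agrees near that point with a globally smooth map. -/
theorem exists_contDiff_extension {B G : Type*} [NormedAddCommGroup B] [NormedSpace ℝ B]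
    [FiniteDimensional ℝ B] [NormedAddCommGroup G] [NormedSpace ℝ G] {g : B → G} {b₀ : B}
    (hg : ∀ᶠ b in 𝓝 b₀, ContDiffAt ℝ ∞ g b) :
    ∃ g' : B → G, ContDiff ℝ ∞ g' ∧ g' =ᶠ[𝓝 b₀] g := by
  obtain ⟨ε, hε, h⟩ := Metric.eventually_nhds_iff_ball.1 hg
  let χ : ContDiffBump b₀ := ⟨ε / 4, ε / 2, by positivity, by linarith⟩
  refine ⟨fun b => χ b • g b, contDiff_iff_contDiffAt.2 fun b => ?_, ?_⟩
  · by_cases hb : b ∈ Metric.ball b₀ ε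
    · exact χ.contDiff.contDiffAt.smul (h b hb)
    · have h0 : (fun b => χ b • g b) =ᶠ[𝓝 b] fun _ => 0 := by
        have : (Metric.closedBall b₀ (ε / 2))ᶜ ∈ 𝓝 b :=
          Metric.isClosed_closedBall.isOpen_compl.mem_nhds fun h' =>
            hb (Metric.closedBall_subset_ball (by linarith) h')
        filter_upwards [this] with x hx
        rw [χ.zero_of_le_dist (not_le.1 (show ¬ dist x b₀ ≤ ε / 2 from hx)).le, zero_smul]
      exact contDiffAt_const.congr_of_eventuallyEq h0
  · filter_upwards [χ.eventuallyEq_one] with b hb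
    rw [hb]
    simp

end LinearAlgebra

/-! ### Prolonged frames and generic configurations. -/

section Frames

variable {n r m : ℕ}

/-- The linear combinations of the fields `X j` at a point of `ℝ × ℝⁿ`. -/
noncomputable def fieldFrame (X : Fin r → TDVectorField n) (z : ℝ × (Fin n → ℝ)) :
    (Fin r → ℝ) →L[ℝ] (Fin n → ℝ) :=
  ∑ j, (ContinuousLinearMap.proj (R := ℝ) (φ := fun _ : Fin r => ℝ) j).smulRight (X j z.1 z.2)

/-- The sum of the coefficients. -/
noncomputable def coeffSum (r : ℕ) : (Fin r → ℝ) →L[ℝ] ℝ :=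
  ∑ j, ContinuousLinearMap.proj (R := ℝ) (φ := fun _ : Fin r => ℝ) j

/-- The linear combinations of the diagonal prolongations of the autonomizations of the `X j`. -/
noncomputable def prolongedFrame (X : Fin r → TDVectorField n) (b : ℝ × (Fin m → Fin n → ℝ)) :
    (Fin r → ℝ) →L[ℝ] ℝ × (Fin m → Fin n → ℝ) :=
  (coeffSum r).prod (ContinuousLinearMap.pi fun i => fieldFrame X (b.1, b.2 i))

@[simp] theorem fieldFrame_apply (X : Fin r → TDVectorField n) (z : ℝ × (Fin n → ℝ))
    (a : Fin r → ℝ) : fieldFrame X z a = ∑ j, a j • X j z.1 z.2 := by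
  simp [fieldFrame]

@[simp] theorem coeffSum_apply (a : Fin r → ℝ) : coeffSum r a = ∑ j, a j := by
  simp [coeffSum]

@[simp] theorem prolongedFrame_apply (X : Fin r → TDVectorField n)
    (b : ℝ × (Fin m → Fin n → ℝ)) (a : Fin r → ℝ) :
    prolongedFrame X b a = (coeffSum r a, fun i => fieldFrame X (b.1, b.2 i) a) := rfl

theorem contDiff_fieldFrame {X : Fin r → TDVectorField n} (hX : ∀ j, (X j).Smooth) :
    ContDiff ℝ ∞ (fieldFrame X) := by
  refine ContDiff.sum fun j _ => ?_
  exact ((ContinuousLinearMap.smulRightL ℝ (Fin r → ℝ) (Fin n → ℝ)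
    (ContinuousLinearMap.proj j)).contDiff).comp (hX j)

theorem contDiff_prolongedFrame {X : Fin r → TDVectorField n} (hX : ∀ j, (X j).Smooth) :
    ContDiff ℝ ∞ (prolongedFrame (m := m) X) := by
  refine contDiff_clm_apply_iff.2 fun a => ?_
  simp only [prolongedFrame_apply]
  refine contDiff_const.prodMk (contDiff_pi.2 fun i => ?_)
  exact ((contDiff_fieldFrame hX).comp (contDiff_fst.prodMk
    ((contDiff_apply ℝ (Fin n → ℝ) i).comp contDiff_snd))).clm_apply contDiff_const

/-- The coefficients of the combinations of the autonomizations vanishing at time `t`. -/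
noncomputable def commonKernel (X : Fin r → TDVectorField n) (t : ℝ) : Submodule ℝ (Fin r → ℝ) :=
  LinearMap.ker (coeffSum r).toLinearMap ⊓ ⨅ y, LinearMap.ker (fieldFrame X (t, y)).toLinearMap

theorem mem_commonKernel {X : Fin r → TDVectorField n} {t : ℝ} {a : Fin r → ℝ} :
    a ∈ commonKernel X t ↔ coeffSum r a = 0 ∧ ∀ y, fieldFrame X (t, y) a = 0 := by
  simp [commonKernel, Submodule.mem_iInf]

theorem commonKernel_le (X : Fin r → TDVectorField n) (b : ℝ × (Fin m → Fin n → ℝ)) :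
    commonKernel X b.1 ≤ LinearMap.ker (prolongedFrame X b).toLinearMap := fun a ha => by
  rw [mem_commonKernel] at ha
  rw [LinearMap.mem_ker]
  exact Prod.ext ha.1 (funext fun i => ha.2 _)

/-- Each point that is still needed lowers the dimension of the common kernel, so `r` points suffice
for `r` coefficients. -/
theorem exists_ker_prolongedFrame_eq (X : Fin r → TDVectorField n) (t : ℝ) :
    ∃ p : Fin r → Fin n → ℝ,
      LinearMap.ker (prolongedFrame X (t, p)).toLinearMap = commonKernel X t := by
  obtain ⟨p, hp⟩ := exists_separating_points (fun y => (fieldFrame X (t, y)).toLinearMap) r ⊤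
    (by simp)
  refine ⟨p, le_antisymm (fun a ha => ?_) (commonKernel_le X (t, p))⟩
  rw [LinearMap.mem_ker] at ha
  exact mem_commonKernel.2 ⟨congrArg Prod.fst ha,
    hp a trivial fun i => congrFun (congrArg Prod.snd ha) i⟩

/-- The configurations at which the prolongations have locally maximal rank. -/
def genericConfigurations (X : Fin r → TDVectorField n) (m : ℕ) :
    Set (ℝ × (Fin m → Fin n → ℝ)) :=
  {w | ∀ᶠ t in 𝓝 w.1, Module.finrank ℝ (LinearMap.ker (prolongedFrame X w).toLinearMap) ≤
    Module.finrank ℝ (commonKernel X t)}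

theorem dense_fst_genericConfigurations (X : Fin r → TDVectorField n) :
    Dense (Prod.fst '' genericConfigurations X r) := by
  rw [dense_iff_inter_open]
  intro U hU hne
  classical
  have hex : ∃ d, ∃ t ∈ U, Module.finrank ℝ (commonKernel X t) = d :=
    ⟨_, hne.some, hne.some_mem, rfl⟩
  -- At a time of `U` where the common kernel has least dimension, no nearby time has a smaller one,
  -- which is the genericity condition.
  obtain ⟨t, ht, htd⟩ := Nat.find_spec hex
  obtain ⟨p, hp⟩ := exists_ker_prolongedFrame_eq X t
  refine ⟨t, ht, (t, p), ?_, rfl⟩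
  filter_upwards [hU.mem_nhds ht] with s hs
  rw [hp, htd]
  exact Nat.find_min' hex ⟨s, hs, rfl⟩

/-- A left inverse of the prolonged frame near a given configuration. -/
theorem exists_frame_leftInverse {X : Fin r → TDVectorField n} (hX : ∀ j, (X j).Smooth)
    (b₀ : ℝ × (Fin m → Fin n → ℝ)) :
    ∃ (C : Submodule ℝ (Fin r → ℝ)) (π : ℝ × (Fin m → Fin n → ℝ) →L[ℝ] C),
      ∀ᶠ b in 𝓝 b₀, (∃ e : C ≃L[ℝ] C, (e : C →L[ℝ] C) = π ∘L prolongedFrame X b ∘L C.subtypeL) ∧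
        Module.finrank ℝ (LinearMap.ker (π ∘L prolongedFrame X b).toLinearMap) ≤
          Module.finrank ℝ (LinearMap.ker (prolongedFrame X b₀).toLinearMap) := by
  obtain ⟨C, π, h1, h2⟩ := exists_leftInverse_on_complement (prolongedFrame X b₀)
  refine ⟨C, π, ?_⟩
  have hc : ContinuousAt (fun b => π ∘L prolongedFrame X b ∘L C.subtypeL) b₀ :=
    continuousAt_const.clm_comp
      (((contDiff_prolongedFrame hX).continuous.continuousAt).clm_comp continuousAt_const)
  have h3 := (ContinuousLinearEquiv.refl ℝ C).nhds
  rw [show ((ContinuousLinearEquiv.refl ℝ C : C ≃L[ℝ] C) : C →L[ℝ] C) =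
    π ∘L prolongedFrame X b₀ ∘L C.subtypeL from h1.symm] at h3
  filter_upwards [hc.eventually h3] with b ⟨e, he⟩
  refine ⟨⟨e, he⟩, h2 _ ?_⟩
  rw [ContinuousLinearMap.comp_assoc, ← he]
  exact e.injective

/-- The kernel dimension is upper semicontinuous: `ker F_b ≤ ker (π F_b)`, and the latter is no
larger in dimension than `ker F_{b₀}`. -/
theorem isOpen_genericConfigurations {X : Fin r → TDVectorField n} (hX : ∀ j, (X j).Smooth) :
    IsOpen (genericConfigurations X m) := by
  rw [isOpen_iff_mem_nhds]
  intro b₀ hb₀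
  obtain ⟨C, π, h⟩ := exists_frame_leftInverse hX b₀
  have h' : ∀ᶠ b : ℝ × (Fin m → Fin n → ℝ) in 𝓝 b₀, ∀ᶠ t in 𝓝 b.1,
      Module.finrank ℝ (LinearMap.ker (prolongedFrame X b₀).toLinearMap) ≤
        Module.finrank ℝ (commonKernel X t) :=
    (continuousAt_fst (p := b₀)).eventually (Filter.Eventually.eventually_nhds hb₀)
  filter_upwards [h, h'] with b hb hb'
  filter_upwards [hb'] with t ht
  refine le_trans (le_trans (Submodule.finrank_mono ?_) hb.2) ht
  intro a ha
  rw [LinearMap.mem_ker] at ha ⊢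
  change π (prolongedFrame X b a) = 0
  rw [show prolongedFrame X b a = 0 from ha, map_zero]

end Frames

/-! ### Bracket relations for the frames. -/

section Brackets

variable {n r m : ℕ}

theorem TDVectorField.Smooth.hasFDerivAt_autonomization {X : TDVectorField n} (hX : X.Smooth)
    (z : ℝ × (Fin n → ℝ)) :
    HasFDerivAt X.autonomization ((0 : ℝ × (Fin n → ℝ) →L[ℝ] ℝ).prod
      (fderiv ℝ (fun q : ℝ × (Fin n → ℝ) => X q.1 q.2) z)) z :=
  (hasFDerivAt_const (1 : ℝ) z).prodMk
    ((ContDiff.differentiable hX (by simp)) z).hasFDerivAt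

theorem lieBracket_autonomization {X Z : TDVectorField n} (hX : X.Smooth) (hZ : Z.Smooth)
    (z : ℝ × (Fin n → ℝ)) :
    VectorField.lieBracket ℝ X.autonomization Z.autonomization z =
      (0, fderiv ℝ (fun q : ℝ × (Fin n → ℝ) => Z q.1 q.2) z (1, X z.1 z.2) -
        fderiv ℝ (fun q : ℝ × (Fin n → ℝ) => X q.1 q.2) z (1, Z z.1 z.2)) := by
  rw [VectorField.lieBracket, (hX.hasFDerivAt_autonomization z).fderiv,
    (hZ.hasFDerivAt_autonomization z).fderiv]
  simp [TDVectorField.autonomization]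

theorem fderiv_fieldFrame {X : Fin r → TDVectorField n} (hX : ∀ j, (X j).Smooth)
    (z v : ℝ × (Fin n → ℝ)) (a : Fin r → ℝ) :
    fderiv ℝ (fieldFrame X) z v a =
      ∑ j, a j • fderiv ℝ (fun q : ℝ × (Fin n → ℝ) => X j q.1 q.2) z v := by
  have h1 : HasFDerivAt (fun z => fieldFrame X z a) ((fderiv ℝ (fieldFrame X) z).flip a) z := by
    simpa using ((contDiff_fieldFrame hX).differentiable (by simp) z).hasFDerivAt.clm_apply
      (hasFDerivAt_const a z)
  have h2 : HasFDerivAt (fun z => fieldFrame X z a)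
      (∑ j, a j • fderiv ℝ (fun q : ℝ × (Fin n → ℝ) => X j q.1 q.2) z) z := by
    simp only [fieldFrame_apply]
    exact HasFDerivAt.fun_sum fun j _ =>
      (((hX j).differentiable (by simp)) z).hasFDerivAt.const_smul (a j)
  have := DFunLike.congr_fun (h1.unique h2) v
  simpa using this

theorem fderiv_prolongedFrame {X : Fin r → TDVectorField n} (hX : ∀ j, (X j).Smooth)
    (b v : ℝ × (Fin m → Fin n → ℝ)) (a : Fin r → ℝ) :
    fderiv ℝ (prolongedFrame X) b v a =
      (0, fun i => fderiv ℝ (fieldFrame X) (b.1, b.2 i) (v.1, v.2 i) a) := by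
  have h1 : HasFDerivAt (fun b => prolongedFrame (m := m) X b a)
      ((fderiv ℝ (prolongedFrame X) b).flip a) b := by
    simpa using ((contDiff_prolongedFrame hX).differentiable (by simp) b).hasFDerivAt.clm_apply
      (hasFDerivAt_const a b)
  let pt : Fin m → ℝ × (Fin m → Fin n → ℝ) →L[ℝ] ℝ × (Fin n → ℝ) := fun i =>
    (ContinuousLinearMap.fst ℝ _ _).prod
      (ContinuousLinearMap.proj i ∘L ContinuousLinearMap.snd ℝ _ _)
  have h2 : HasFDerivAt (fun b => prolongedFrame (m := m) X b a)
      ((0 : ℝ × (Fin m → Fin n → ℝ) →L[ℝ] ℝ).prod (ContinuousLinearMap.pi fun i =>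
        (fderiv ℝ (fieldFrame X) (pt i b) ∘L pt i).flip a)) b := by
    simp only [prolongedFrame_apply]
    refine (hasFDerivAt_const _ b).prodMk (hasFDerivAt_pi.2 fun i => ?_)
    have h3 : HasFDerivAt (fun b => fieldFrame X (pt i b))
        (fderiv ℝ (fieldFrame X) (pt i b) ∘L pt i) b :=
      HasFDerivAt.comp b ((contDiff_fieldFrame hX).differentiable (by simp) (pt i b)).hasFDerivAt
        (pt i).hasFDerivAt
    have h4 := h3.clm_apply (hasFDerivAt_const a b)
    rw [ContinuousLinearMap.comp_zero, zero_add] at h4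
    exact h4
  have := DFunLike.congr_fun (h1.unique h2) v
  simpa [pt] using this

/-- The fields `X j` satisfy `[X̄ⱼ, X̄ₖ] = ∑ₗ fⱼₖₗ(t) X̄ₗ`. -/
def IsClosedUnderBrackets (X : Fin r → TDVectorField n) (f : Fin r → Fin r → Fin r → ℝ → ℝ) :
    Prop :=
  ∀ j k t x, VectorField.lieBracket ℝ (X j).autonomization (X k).autonomization (t, x) =
    ∑ l, f j k l t • (X l).autonomization (t, x)

/-- The coefficients of the bracket of two combinations of the `X̄ⱼ`. -/
noncomputable def bracketCoeff (f : Fin r → Fin r → Fin r → ℝ → ℝ) (t : ℝ)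
    (a a' : Fin r → ℝ) : Fin r → ℝ :=
  -- The order `f k j l` matches the bracket taken with `a'` first: the derivative of the
  -- `a`-combination along the `a'`-combination comes with a plus sign.
  fun l => ∑ j, ∑ k, a j * a' k * f k j l t

variable {X : Fin r → TDVectorField n} {f : Fin r → Fin r → Fin r → ℝ → ℝ}

/-- Autonomizations have time component `1`, their brackets time component `0`. -/
theorem IsClosedUnderBrackets.sum_coeff (hX : ∀ j, (X j).Smooth)
    (hf : IsClosedUnderBrackets X f) (j k : Fin r) (t : ℝ) : ∑ l, f j k l t = 0 := by
  have h := hf j k t 0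
  rw [lieBracket_autonomization (hX j) (hX k)] at h
  have := congrArg Prod.fst h
  simpa [TDVectorField.autonomization, Prod.fst_sum] using this.symm

theorem IsClosedUnderBrackets.coeffSum_bracketCoeff (hX : ∀ j, (X j).Smooth)
    (hf : IsClosedUnderBrackets X f) (t : ℝ) (a a' : Fin r → ℝ) :
    coeffSum r (bracketCoeff f t a a') = 0 := by
  simp only [coeffSum_apply, bracketCoeff]
  rw [Finset.sum_comm]
  refine Finset.sum_eq_zero fun j _ => ?_
  rw [Finset.sum_comm]
  refine Finset.sum_eq_zero fun k _ => ?_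
  rw [← Finset.mul_sum, hf.sum_coeff hX, mul_zero]

theorem IsClosedUnderBrackets.fieldFrame_bracket (hX : ∀ j, (X j).Smooth)
    (hf : IsClosedUnderBrackets X f) (z : ℝ × (Fin n → ℝ)) (a a' : Fin r → ℝ) :
    fderiv ℝ (fieldFrame X) z (coeffSum r a', fieldFrame X z a') a -
      fderiv ℝ (fieldFrame X) z (coeffSum r a, fieldFrame X z a) a' =
      fieldFrame X z (bracketCoeff f z.1 a a') := by
  have hv : ∀ a : Fin r → ℝ, (coeffSum r a, fieldFrame X z a) =
      ∑ k, a k • ((1 : ℝ), X k z.1 z.2) := fun a => by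
    ext <;> simp [Prod.fst_sum, Prod.snd_sum]
  have hb : ∀ j k, fderiv ℝ (fun q : ℝ × (Fin n → ℝ) => X j q.1 q.2) z (1, X k z.1 z.2) -
      fderiv ℝ (fun q : ℝ × (Fin n → ℝ) => X k q.1 q.2) z (1, X j z.1 z.2) =
      ∑ l, f k j l z.1 • X l z.1 z.2 := fun j k => by
    have h := hf k j z.1 z.2
    rw [lieBracket_autonomization (hX k) (hX j)] at h
    have := congrArg Prod.snd h
    simpa [TDVectorField.autonomization, Prod.snd_sum] using this
  rw [fderiv_fieldFrame hX, fderiv_fieldFrame hX, hv, hv]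
  simp only [map_sum, map_smul, Finset.smul_sum, smul_smul]
  rw [Finset.sum_comm (f := fun j k => (a' j * a k) •
    fderiv ℝ (fun q : ℝ × (Fin n → ℝ) => X j q.1 q.2) z (1, X k z.1 z.2)),
    ← Finset.sum_sub_distrib]
  simp only [← Finset.sum_sub_distrib, mul_comm (a' _) (a _), ← smul_sub, hb]
  rw [fieldFrame_apply]
  simp only [bracketCoeff, Finset.sum_smul, Finset.smul_sum, smul_smul]
  rw [Finset.sum_comm_cycle]

/-- The relation holds at each point separately, with coefficients depending only on the common time
`b.1`; this is where dependence of `f` on `t` alone is essential. -/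
theorem IsClosedUnderBrackets.prolongedFrame_bracket (hX : ∀ j, (X j).Smooth)
    (hf : IsClosedUnderBrackets X f) (b : ℝ × (Fin m → Fin n → ℝ)) (a a' : Fin r → ℝ) :
    fderiv ℝ (prolongedFrame X) b (prolongedFrame X b a') a -
      fderiv ℝ (prolongedFrame X) b (prolongedFrame X b a) a' =
      prolongedFrame X b (bracketCoeff f b.1 a a') := by
  rw [fderiv_prolongedFrame hX, fderiv_prolongedFrame hX]
  simp only [prolongedFrame_apply, Prod.mk_sub_mk, sub_zero, hf.coeffSum_bracketCoeff hX]
  refine Prod.ext rfl (funext fun i => ?_)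
  exact hf.fieldFrame_bracket hX (b.1, b.2 i) a a'

end Brackets

/-! ### Construction of the superposition rule. -/

section SuperpositionRule

variable {n r m : ℕ} {X : Fin r → TDVectorField n} {f : Fin r → Fin r → Fin r → ℝ → ℝ}

/-- Near a generic configuration the prolonged distribution has a smooth frame which is normalized
by a linear map. -/
theorem exists_normalized_frame (hX : ∀ j, (X j).Smooth) {b₀ : ℝ × (Fin m → Fin n → ℝ)}
    (hb₀ : b₀ ∈ genericConfigurations X m) :
    ∃ (C : Submodule ℝ (Fin r → ℝ)) (π : ℝ × (Fin m → Fin n → ℝ) →L[ℝ] C)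
      (μ : ℝ × (Fin m → Fin n → ℝ) → C →L[ℝ] (Fin r → ℝ)), ContDiff ℝ ∞ μ ∧
      ∀ᶠ b in 𝓝 b₀, (∀ c, π (prolongedFrame X b (μ b c)) = c) ∧
        ∀ a, π (prolongedFrame X b a) = 0 → a ∈ commonKernel X b.1 := by
  obtain ⟨C, π, h⟩ := exists_frame_leftInverse hX b₀
  have hsm : ∀ᶠ b in 𝓝 b₀, ContDiffAt ℝ ∞
      (fun b => C.subtypeL ∘L (π ∘L prolongedFrame X b ∘L C.subtypeL).inverse) b := by
    filter_upwards [h] with b ⟨⟨e, he⟩, _⟩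
    refine contDiffAt_const.clm_comp (ContDiffAt.comp b (g := ContinuousLinearMap.inverse) ?_ ?_)
    · rw [← he]
      exact contDiffAt_map_inverse e
    · exact (contDiff_const.clm_comp
        ((contDiff_prolongedFrame hX).clm_comp contDiff_const)).contDiffAt
  obtain ⟨μ, hμ, hμe⟩ := exists_contDiff_extension hsm
  refine ⟨C, π, μ, hμ, ?_⟩
  filter_upwards [h, hμe, (continuousAt_fst (p := b₀)).eventually hb₀] with b ⟨⟨e, he⟩, hrk⟩ h2 h3
  refine ⟨fun c => ?_, fun a ha => ?_⟩
  · rw [h2, ← he, ContinuousLinearMap.inverse_equiv]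
    have := DFunLike.congr_fun he (e.symm c)
    simpa using this.symm
  -- Genericity squeezes the dimensions, so the inclusion is an equality.
  · have hle : commonKernel X b.1 ≤ LinearMap.ker (π ∘L prolongedFrame X b).toLinearMap :=
      (commonKernel_le X b).trans fun a ha => by
        rw [LinearMap.mem_ker] at ha ⊢
        change π (prolongedFrame X b a) = 0
        rw [show prolongedFrame X b a = 0 from ha, map_zero]
    rw [Submodule.eq_of_le_of_finrank_le hle (hrk.trans h3)]
    exact ha

theorem fderiv_frame_comp {B E V C : Type*} [NormedAddCommGroup B] [NormedSpace ℝ B]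
    [NormedAddCommGroup E] [NormedSpace ℝ E] [NormedAddCommGroup V] [NormedSpace ℝ V]
    [NormedAddCommGroup C] [NormedSpace ℝ C] {F : B → V →L[ℝ] E} {μ : B → C →L[ℝ] V} {b : B}
    (hF : DifferentiableAt ℝ F b) (hμ : DifferentiableAt ℝ μ b) (v : B) (c : C) :
    fderiv ℝ (fun b => F b ∘L μ b) b v c =
      fderiv ℝ F b v (μ b c) + F b (fderiv ℝ μ b v c) := by
  rw [(hF.hasFDerivAt.clm_comp hμ.hasFDerivAt).fderiv]
  simp [add_comm]

universe u

theorem isIntegrableAt_prod {B E C : Type u} [NormedAddCommGroup B] [NormedSpace ℝ B]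
    [NormedAddCommGroup E] [NormedSpace ℝ E] [NormedAddCommGroup C] [NormedSpace ℝ C]
    {VB : B → C →L[ℝ] B} {VE : B × E → C →L[ℝ] E} {b : B} {y : E}
    (hB : DifferentiableAt ℝ VB b) (hE : DifferentiableAt ℝ VE (b, y)) (hIB : IsIntegrableAt VB b)
    (hIE : ∀ c d, fderiv ℝ VE (b, y) (VB b d, VE (b, y) d) c =
      fderiv ℝ VE (b, y) (VB b c, VE (b, y) c) d) :
    IsIntegrableAt (fun q : B × E => (VB q.1).prod (VE q)) (b, y) := by
  have h1 : HasFDerivAt (fun q : B × E => VB q.1) (fderiv ℝ VB b ∘L ContinuousLinearMap.fst ℝ B E)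
      (b, y) := HasFDerivAt.comp (g := VB) (b, y) hB.hasFDerivAt hasFDerivAt_fst
  have h2 : DifferentiableAt ℝ (fun q : B × E => (VB q.1).prod (VE q)) (b, y) := by
    have h3 : (fun q : B × E => (VB q.1).prod (VE q)) = fun q =>
        ContinuousLinearMap.inl ℝ _ _ ∘L VB q.1 + ContinuousLinearMap.inr ℝ _ _ ∘L VE q := by
      ext q c <;> simp
    rw [h3]
    exact ((differentiableAt_const _).clm_comp h1.differentiableAt).add
      ((differentiableAt_const _).clm_comp hE)
  have hfd : ∀ v c, fderiv ℝ (fun q : B × E => (VB q.1).prod (VE q)) (b, y) v c =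
      (fderiv ℝ VB b v.1 c, fderiv ℝ VE (b, y) v c) := fun v c => by
    have h4 := h2.hasFDerivAt.clm_apply (hasFDerivAt_const c (b, y))
    have h5 := (h1.clm_apply (hasFDerivAt_const c (b, y))).prodMk
      (hE.hasFDerivAt.clm_apply (hasFDerivAt_const c (b, y)))
    simpa using DFunLike.congr_fun (h4.unique h5) v
  intro c d
  rw [hfd, hfd]
  exact Prod.ext (hIB c d) (hIE c d)

/-- The distribution spanned by the prolongations to `m + 1` points is integrable near a
generic configuration. -/
theorem isIntegrableAt_frames (hX : ∀ j, (X j).Smooth) (hf : IsClosedUnderBrackets X f)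
    {C : Submodule ℝ (Fin r → ℝ)} {π : ℝ × (Fin m → Fin n → ℝ) →L[ℝ] C}
    {μ : ℝ × (Fin m → Fin n → ℝ) → C →L[ℝ] (Fin r → ℝ)} (hμ : ContDiff ℝ ∞ μ)
    {b : ℝ × (Fin m → Fin n → ℝ)}
    (h : ∀ᶠ b in 𝓝 b, (∀ c, π (prolongedFrame X b (μ b c)) = c) ∧
        ∀ a, π (prolongedFrame X b a) = 0 → a ∈ commonKernel X b.1) :
    IsIntegrableAt (fun b => prolongedFrame X b ∘L μ b) b ∧
    ∀ y, IsIntegrableAt (fun q : (ℝ × (Fin m → Fin n → ℝ)) × (Fin n → ℝ) =>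
      (prolongedFrame X q.1 ∘L μ q.1).prod (fieldFrame X (q.1.1, q.2) ∘L μ q.1)) (b, y) := by
  have hFd := (contDiff_prolongedFrame (m := m) hX).differentiable (by simp) b
  have hμd := hμ.differentiable (by simp) b
  set VB : ℝ × (Fin m → Fin n → ℝ) → C →L[ℝ] ℝ × (Fin m → Fin n → ℝ) :=
    fun b => prolongedFrame X b ∘L μ b with hVB
  have hVBd : DifferentiableAt ℝ VB b := hFd.clm_comp hμd
  -- Coefficients of the bracket of two frame fields, including the derivatives of `μ`.
  -- Normalization makes `π` kill this bracket, so `w` is in the common kernel and also annihilates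
  -- the fields at any additional point.
  let w : C → C → Fin r → ℝ := fun c d => bracketCoeff f b.1 (μ b c) (μ b d) +
    (fderiv ℝ μ b (VB b d) c - fderiv ℝ μ b (VB b c) d)
  have hB : ∀ c d, fderiv ℝ VB b (VB b d) c - fderiv ℝ VB b (VB b c) d =
      prolongedFrame X b (w c d) := fun c d => by
    rw [fderiv_frame_comp hFd hμd, fderiv_frame_comp hFd hμd]
    simp only [w, map_add, map_sub]
    rw [← hf.prolongedFrame_bracket hX b (μ b c) (μ b d)]
    simp only [hVB, ContinuousLinearMap.comp_apply]
    abel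
  have hconst : ∀ v c, π (fderiv ℝ VB b v c) = 0 := fun v c => by
    have h1 : HasFDerivAt (fun b => π (VB b c)) (π ∘L (fderiv ℝ VB b).flip c) b := by
      refine π.hasFDerivAt.comp b ?_
      simpa using hVBd.hasFDerivAt.clm_apply (hasFDerivAt_const c b)
    have h2 : (fun b => π (VB b c)) =ᶠ[𝓝 b] fun _ => c := h.mono fun b hb => hb.1 c
    have h3 := (h1.congr_of_eventuallyEq h2.symm).unique (hasFDerivAt_const c b)
    simpa using DFunLike.congr_fun h3 v
  have hker : ∀ c d, w c d ∈ commonKernel X b.1 := fun c d => by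
    refine h.self_of_nhds.2 _ ?_
    rw [← hB, map_sub, hconst, hconst, sub_zero]
  have hker' : ∀ c d, prolongedFrame X b (w c d) = 0 := fun c d =>
    LinearMap.mem_ker.1 (commonKernel_le X b (hker c d))
  have hIB : IsIntegrableAt VB b := fun c d => by
    rw [← sub_eq_zero, hB, hker']
  refine ⟨hIB, fun y c d => ?_⟩
  let pt : (ℝ × (Fin m → Fin n → ℝ)) × (Fin n → ℝ) →L[ℝ] ℝ × (Fin n → ℝ) :=
    ((ContinuousLinearMap.fst ℝ _ _) ∘L (ContinuousLinearMap.fst ℝ _ _)).prod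
      (ContinuousLinearMap.snd ℝ _ _)
  have hEd := (contDiff_fieldFrame hX).differentiable (by simp) (b.1, y)
  have hE1 : HasFDerivAt (fun q : (ℝ × (Fin m → Fin n → ℝ)) × (Fin n → ℝ) =>
      fieldFrame X (q.1.1, q.2)) (fderiv ℝ (fieldFrame X) (b.1, y) ∘L pt) (b, y) :=
    HasFDerivAt.comp (f := pt) (b, y) hEd.hasFDerivAt pt.hasFDerivAt
  have hμ1 : HasFDerivAt (fun q : (ℝ × (Fin m → Fin n → ℝ)) × (Fin n → ℝ) => μ q.1)
      (fderiv ℝ μ b ∘L ContinuousLinearMap.fst ℝ _ _) (b, y) :=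
    HasFDerivAt.comp (f := Prod.fst) (b, y) hμd.hasFDerivAt hasFDerivAt_fst
  set VE : (ℝ × (Fin m → Fin n → ℝ)) × (Fin n → ℝ) → C →L[ℝ] (Fin n → ℝ) :=
    fun q => fieldFrame X (q.1.1, q.2) ∘L μ q.1 with hVE
  have hVEd : DifferentiableAt ℝ VE (b, y) :=
    hE1.differentiableAt.clm_comp hμ1.differentiableAt
  refine isIntegrableAt_prod hVBd hVEd hIB (fun c d => ?_) c d
  rw [← sub_eq_zero, fderiv_frame_comp hE1.differentiableAt hμ1.differentiableAt,
    fderiv_frame_comp hE1.differentiableAt hμ1.differentiableAt, hE1.fderiv, hμ1.fderiv]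
  have hbr := hf.fieldFrame_bracket hX (b.1, y) (μ b c) (μ b d)
  have h0 := (mem_commonKernel.1 (hker c d)).2 y
  simp only [w, map_add, map_sub] at h0
  rw [← hbr] at h0
  rw [← h0]
  simp only [hVE, hVB, pt, ContinuousLinearMap.comp_apply, ContinuousLinearMap.prod_apply,
    ContinuousLinearMap.coe_fst', ContinuousLinearMap.coe_snd', prolongedFrame_apply]
  abel

theorem TDVectorField.Smooth.eventuallyEq_of_isSolution {Y : TDVectorField n} (hY : Y.Smooth)
    {x y : ℝ → Fin n → ℝ} {t₀ : ℝ} (hx : ∀ᶠ t in 𝓝 t₀, HasDerivAt x (Y t (x t)) t)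
    (hy : ∀ᶠ t in 𝓝 t₀, HasDerivAt y (Y t (y t)) t) (h : x t₀ = y t₀) : x =ᶠ[𝓝 t₀] y := by
  have hs : ContDiffAt ℝ 1 Y.autonomization (t₀, x t₀) :=
    (contDiff_const.prodMk ((ContDiff.of_le hY (by exact_mod_cast le_top)))).contDiffAt
  obtain ⟨K, s, hs, hK⟩ := hs.exists_lipschitzOnWith
  have key : ∀ z : ℝ → Fin n → ℝ, z t₀ = x t₀ → (∀ᶠ t in 𝓝 t₀, HasDerivAt z (Y t (z t)) t) →
      ∀ᶠ t in 𝓝 t₀, HasDerivAt (fun t => (t, z t)) (Y.autonomization (t, z t)) t ∧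
        (t, z t) ∈ s := fun z hz0 hz => by
    have hc : ContinuousAt (fun t => (t, z t)) t₀ :=
      continuousAt_id.prodMk hz.self_of_nhds.continuousAt
    filter_upwards [hz, hc.eventually (p := fun q => q ∈ s) (by simp only [hz0]; exact hs)]
      with t h1 h2
    exact ⟨(hasDerivAt_id t).prodMk h1, h2⟩
  have := ODE_solution_unique_of_eventually (v := fun _ => Y.autonomization) (s := fun _ => s)
    (Eventually.of_forall fun _ => hK) (key x rfl hx) (key y h.symm hy) (by rw [h])
  exact this.mono fun t ht => congrArg Prod.snd ht

/-- Around every generic configuration there is a superposition rule. -/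
theorem exists_isSuperpositionRuleAt {Λ : Type*} {Y : Λ → TDVectorField n}
    (hY : ∀ α, (Y α).Smooth) (hX : ∀ j, (X j).Smooth) (hf : IsClosedUnderBrackets X f)
    {β : Λ → Fin r → ℝ → ℝ} (hβ : ∀ α t, ∑ j, β α j t = 1)
    (hYX : ∀ α t x, Y α t x = ∑ j, β α j t • X j t x) {t₀ : ℝ} {p : Fin m → Fin n → ℝ}
    (hp : (t₀, p) ∈ genericConfigurations X m) :
    ∃ Ω Φ, IsSuperpositionRuleAt Y t₀ p Ω Φ := by
  obtain ⟨C, π, μ, hμ, hev⟩ := exists_normalized_frame hX hp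
  have hVB : ContDiff ℝ ∞ (fun b => prolongedFrame (m := m) X b ∘L μ b) :=
    (contDiff_prolongedFrame hX).clm_comp hμ
  have hVE : ContDiff ℝ ∞ (fun q : (ℝ × (Fin m → Fin n → ℝ)) × (Fin n → ℝ) =>
      fieldFrame X (q.1.1, q.2) ∘L μ q.1) :=
    ((contDiff_fieldFrame hX).comp ((contDiff_fst.comp contDiff_fst).prodMk contDiff_snd)).clm_comp
      (hμ.comp contDiff_fst)
  have hint := hev.eventually_nhds.mono fun b hb => isIntegrableAt_frames hX hf hμ hb
  obtain ⟨Ω, Φ, hΩo, hΩ0, hΩN, hsm, hinj, hbij, hder⟩ := exists_leaf_transport _ hVB _ hVE π (t₀, p)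
    (hev.mono fun b hb => hb.1) (hint.mono fun b hb => hb.1) (hint.mono fun b hb => hb.2) hev
  let e : (ℝ × (Fin m → Fin n → ℝ) × (Fin n → ℝ)) ≃L[ℝ] (ℝ × (Fin m → Fin n → ℝ)) × (Fin n → ℝ) :=
    (ContinuousLinearEquiv.prodAssoc ℝ ℝ (Fin m → Fin n → ℝ) (Fin n → ℝ)).symm
  have he : ∀ q, e q = ((q.1, q.2.1), q.2.2) := fun _ => rfl
  have hsolves : ∀ (α : Λ) (t : ℝ) (x : Fin m → ℝ → Fin n → ℝ) (k : Fin n → ℝ),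
      (∀ i, HasDerivAt (x i) (Y α t (x i t)) t) → ((t, fun i => x i t), k) ∈ Ω →
      HasDerivAt (fun t => Φ ((t, fun i => x i t), k)) (Y α t (Φ ((t, fun i => x i t), k))) t := by
    intro α t x k hx hΩt
    set b : ℝ × (Fin m → Fin n → ℝ) := (t, fun i => x i t) with hb
    obtain ⟨h1, h2⟩ := hΩN _ hΩt
    have hYF : ∀ y, Y α t y = fieldFrame X (t, y) (fun j => β α j t) := fun y => by
      rw [hYX, fieldFrame_apply]
    have hbd : HasDerivAt (fun t => ((t, fun i => x i t), k))
        (prolongedFrame X b (fun j => β α j t), 0) t := by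
      refine HasDerivAt.prodMk ?_ (hasDerivAt_const t k)
      rw [prolongedFrame_apply, coeffSum_apply, hβ]
      refine (hasDerivAt_id t).prodMk (hasDerivAt_pi.2 fun i => ?_)
      rw [← hYF]
      exact hx i
    -- The coefficients `β` and their normalized version differ by a member of the common kernel, so
    -- the velocity of the prolonged solution lies in the distribution and `hder` applies to it.
    have hmem : μ b (π (prolongedFrame X b (fun j => β α j t))) - (fun j => β α j t) ∈
        commonKernel X b.1 := by
      refine h2 _ ?_
      rw [map_sub, map_sub, h1, sub_self]
    have hB := LinearMap.mem_ker.1 (commonKernel_le X b hmem)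
    have hE := (mem_commonKernel.1 hmem).2 (Φ (b, k))
    simp only [ContinuousLinearMap.coe_coe] at hB
    rw [map_sub, sub_eq_zero] at hB hE
    have h3 := hder _ hΩt (π (prolongedFrame X b (fun j => β α j t)))
    simp only [ContinuousLinearMap.comp_apply] at h3
    rw [hB, hE] at h3
    have h4 := HasFDerivAt.comp_hasDerivAt (l := Φ) t
      ((hsm _ hΩt).differentiableAt (by simp)).hasFDerivAt hbd
    rw [h3] at h4
    rw [hYF]
    exact h4
  refine ⟨e ⁻¹' Ω, fun t x k => Φ ((t, x), k), ?_, ?_, ?_, ?_, ?_, ?_⟩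
  · exact hΩo.preimage e.continuous
  · intro q hq
    exact ((hsm (e q) hq).comp q e.contDiff.contDiffAt).contDiffWithinAt
  · intro t x k k' h h' hk
    exact hinj _ _ _ h h' hk
  · intro t x k h
    exact hbij _ h
  · intro α a b x k hx hΩt t ht
    exact hsolves α t x k (fun i => hx i t ht) (hΩt t ht)
  · intro α a b x y ht₀ hx hxp hy
    have hxp' : (fun i => x i t₀) = p := funext hxp
    -- The constant is the initial value, as `Φ` is the identity in `k` over `(t₀, p)`.
    refine ⟨y t₀, (hΩ0 (y t₀)).1, ?_⟩
    have hI : Ioo a b ∈ 𝓝 t₀ := Ioo_mem_nhds ht₀.1 ht₀.2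
    have hc : ContinuousAt (fun t => ((t, fun i => x i t), y t₀)) t₀ :=
      (continuousAt_id.prodMk (continuousAt_pi.2 fun i =>
        (hx i t₀ ht₀).continuousAt)).prodMk continuousAt_const
    have hmem : ∀ᶠ t in 𝓝 t₀, ((t, fun i => x i t), y t₀) ∈ Ω :=
      hc.eventually (p := fun q => q ∈ Ω)
        (hΩo.mem_nhds (by simp only [hxp']; exact (hΩ0 (y t₀)).1))
    refine (hY α).eventuallyEq_of_isSolution (x := y)
      (y := fun t => Φ ((t, fun i => x i t), y t₀)) ?_ ?_ ?_
    · filter_upwards [hI] with t ht using hy t ht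
    · filter_upwards [hI, hmem] with t ht h
      exact hsolves α t x (y t₀) (fun i => hx i t ht) h
    · simp only [hxp']
      exact (hΩ0 (y t₀)).2.symm

theorem isLieFamily_of_fields {Λ : Type*} {Y : Λ → TDVectorField n}
    (hY : ∀ α, (Y α).Smooth) (hX : ∀ j, (X j).Smooth) (hf : IsClosedUnderBrackets X f)
    {β : Λ → Fin r → ℝ → ℝ} (hβ : ∀ α t, ∑ j, β α j t = 1)
    (hYX : ∀ α t x, (Y α).autonomization (t, x) = ∑ j, β α j t • (X j).autonomization (t, x)) :
    IsLieFamily Y :=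
  ⟨r, genericConfigurations X r, isOpen_genericConfigurations hX,
    dense_fst_genericConfigurations X, fun _ _ hp =>
      exists_isSuperpositionRuleAt hY hX hf hβ (fun α t x => by
        simpa [TDVectorField.autonomization, Prod.snd_sum] using congrArg Prod.snd (hYX α t x)) hp⟩

end SuperpositionRule

/-! ### Smooth countable sums. -/

section SmoothSums

/-- A countable series of smooth functions can be made smooth by positive weights. -/
theorem exists_contDiff_tsum_smul {ι F G : Type*} [Countable ι] [NormedAddCommGroup F]
    [NormedSpace ℝ F] [FiniteDimensional ℝ F] [NormedAddCommGroup G] [NormedSpace ℝ G]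
    [CompleteSpace G] (g : ι → F → G) (hg : ∀ i, ContDiff ℝ ∞ (g i)) :
    ∃ ε : ι → ℝ, (∀ i, 0 < ε i) ∧ ContDiff ℝ ∞ fun x => ∑' i, ε i • g i x := by
  obtain ⟨e, he⟩ := Countable.exists_injective_nat ι
  let χ : ℕ → ContDiffBump (0 : F) := fun R => ⟨R + 1, R + 2, by positivity, by linarith⟩
  have hsm : ∀ i R, ContDiff ℝ ∞ (fun x => χ R x • g i x) := fun i R =>
    (χ R).contDiff.smul (hg i)
  have hbd : ∀ i R k, ∃ C, ∀ x, ‖iteratedFDeriv ℝ k (fun x => χ R x • g i x) x‖ ≤ C :=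
    fun i R k => (((χ R).hasCompactSupport.smul_right (f' := g i)).iteratedFDeriv
      k).exists_bound_of_continuous
      ((hsm i R).continuous_iteratedFDeriv (by exact_mod_cast le_top))
  choose C hC using hbd
  have hC0 : ∀ i R k, 0 ≤ C i R k := fun i R k => (norm_nonneg _).trans (hC i R k 0)
  -- `S i` dominates the derivatives of order at most `e i` for cut-off radii at most `e i`. For
  -- fixed radius and order this covers all but finitely many `i`, which suffices for summability.
  let S : ι → ℝ := fun i => ∑ R ∈ Finset.range (e i + 1), ∑ k ∈ Finset.range (e i + 1), C i R k
  have hS0 : ∀ i, 0 ≤ S i := fun i =>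
    Finset.sum_nonneg fun R _ => Finset.sum_nonneg fun k _ => hC0 i R k
  have hCS : ∀ i R k, R ≤ e i → k ≤ e i → C i R k ≤ S i := fun i R k hR hk =>
    (Finset.single_le_sum (f := fun k => C i R k) (fun k _ => hC0 i R k)
      (Finset.mem_range_succ_iff.2 hk)).trans
    (Finset.single_le_sum (f := fun R => ∑ k ∈ Finset.range (e i + 1), C i R k)
      (fun R _ => Finset.sum_nonneg fun k _ => hC0 i R k) (Finset.mem_range_succ_iff.2 hR))
  let ε : ι → ℝ := fun i => (1 / 2) ^ e i / (1 + S i)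
  have hε : ∀ i, 0 < ε i := fun i => div_pos (by positivity) (by linarith [hS0 i])
  refine ⟨ε, hε, contDiff_iff_contDiffAt.2 fun x₀ => ?_⟩
  obtain ⟨R, hR⟩ := exists_nat_ge ‖x₀‖
  have key : ContDiff ℝ ∞ fun x => ∑' i, ε i • (χ R x • g i x) := by
    refine contDiff_tsum_of_eventually (v := fun _ i => (1 / 2 : ℝ) ^ e i)
      (fun i => (hsm i R).const_smul (ε i))
      (fun k _ => (summable_geometric_of_lt_one (by norm_num) (by norm_num)).comp_injective he)
      fun k _ => ?_
    have hfin : ∀ᶠ i in cofinite, max R k ≤ e i :=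
      he.tendsto_cofinite.eventually (by
        rw [Nat.cofinite_eq_atTop]
        exact eventually_ge_atTop _)
    filter_upwards [hfin] with i hi x
    have h1 : iteratedFDeriv ℝ k (fun x => ε i • (χ R x • g i x)) x =
        ε i • iteratedFDeriv ℝ k (fun x => χ R x • g i x) x :=
      iteratedFDeriv_const_smul_apply (((hsm i R).of_le (by exact_mod_cast le_top)).contDiffAt)
    rw [h1, norm_smul, Real.norm_of_nonneg (hε i).le]
    calc ε i * ‖iteratedFDeriv ℝ k (fun x => χ R x • g i x) x‖
        ≤ ε i * (1 + S i) := by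
          refine mul_le_mul_of_nonneg_left ?_ (hε i).le
          linarith [hC i R k x, hCS i R k (le_of_max_le_left hi) (le_of_max_le_right hi)]
      _ = (1 / 2) ^ e i := div_mul_cancel₀ _ (by linarith [hS0 i])
  refine key.contDiffAt.congr_of_eventuallyEq ?_
  have : Metric.ball (0 : F) (R + 1) ∈ 𝓝 x₀ :=
    Metric.isOpen_ball.mem_nhds (by rw [mem_ball_zero_iff]; linarith)
  filter_upwards [this] with x hx
  have h1 : χ R x = 1 := (χ R).one_of_mem_closedBall (Metric.ball_subset_closedBall hx)
  simp [h1]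

end SmoothSums

/-! ### Finitely many global generators for spaces of sections. -/

section Generators

variable {n : ℕ}

/-- Pointwise linear independence of smooth fields at a time persists at nearby times. -/
theorem eventually_linearIndependent {k : ℕ} {Z : Fin k → TDVectorField n}
    (hZ : ∀ a, (Z a).Smooth) {t : ℝ} (h : LinearIndependent ℝ fun a => Z a t) :
    ∀ᶠ s in 𝓝 t, LinearIndependent ℝ fun a => Z a s := by
  obtain ⟨q, hq⟩ := exists_separating_points
    (fun y => Fintype.linearCombination ℝ fun a => Z a t y) k ⊤ (by simp)
  have h1 : LinearIndependent ℝ fun a (i : Fin k) => Z a t (q i) := by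
    rw [Fintype.linearIndependent_iff] at h ⊢
    intro c hc
    refine h c (funext fun y => ?_)
    have := hq c trivial (fun i => by
      simpa [Fintype.linearCombination_apply] using congrFun hc i) y
    simpa [Fintype.linearCombination_apply] using this
  have hc : ContinuousAt (fun s a (i : Fin k) => Z a s (q i)) t :=
    continuousAt_pi.2 fun a => continuousAt_pi.2 fun i =>
      ((hZ a).continuous.comp (continuous_id.prodMk continuous_const)).continuousAt
  filter_upwards [hc.eventually h1.eventually] with s hs
  rw [Fintype.linearIndependent_iff] at hs ⊢
  intro c hc
  refine hs c (funext fun i => ?_)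
  simpa using congrFun hc (q i)

/-- Smooth fields taking values in prescribed spaces of autonomous fields. -/
def smoothSections (T : ℝ → Submodule ℝ ((Fin n → ℝ) → Fin n → ℝ)) : Set (TDVectorField n) :=
  {Z | Z.Smooth ∧ ∀ t, Z t ∈ T t}

variable {T : ℝ → Submodule ℝ ((Fin n → ℝ) → Fin n → ℝ)}

/-- Independence is an open condition in time, so it may be tested at a time of the dense set, where
evaluation at `m` points of `ℝⁿ` is injective on `T`. -/
theorem card_le_of_linearIndependent {m : ℕ}
    (hT : Dense {t | ∃ p : Fin m → Fin n → ℝ, ∀ z ∈ T t, (∀ i, z (p i) = 0) → z = 0})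
    {k : ℕ} {Z : Fin k → TDVectorField n} (hZ : ∀ a, Z a ∈ smoothSections T) {t : ℝ}
    (h : LinearIndependent ℝ fun a => Z a t) : k ≤ m * n := by
  obtain ⟨s, ⟨p, hp⟩, hs⟩ := hT.inter_nhds_nonempty
    (eventually_linearIndependent (fun a => (hZ a).1) h)
  have h1 : LinearIndependent ℝ fun a (i : Fin m) => Z a s (p i) := by
    have hs' := Fintype.linearIndependent_iff.1 (show LinearIndependent ℝ fun a => Z a s from hs)
    rw [Fintype.linearIndependent_iff]
    intro c hc
    refine hs' c (hp _ (Submodule.sum_mem _ fun a _ =>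
      (T s).smul_mem _ ((hZ a).2 s)) fun i => ?_)
    simpa using congrFun hc i
  simpa [Module.finrank_pi_fintype] using h1.fintype_card_le_finrank

/-- Near every time at which `k` sections are independent, finitely many sections, the same for
all times, contain `k` independent ones. -/
theorem exists_independent_sections (T : ℝ → Submodule ℝ ((Fin n → ℝ) → Fin n → ℝ)) (k : ℕ) :
    ∃ (N : ℕ) (V : Fin N → Fin k → TDVectorField n), (∀ i a, V i a ∈ smoothSections T) ∧
      ∀ t, (∃ Z : Fin k → TDVectorField n, (∀ a, Z a ∈ smoothSections T) ∧
        LinearIndependent ℝ fun a => Z a t) → ∃ i, LinearIndependent ℝ fun a => V i a t := by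
  classical
  let β := {t : ℝ // ∃ Z : Fin k → TDVectorField n, (∀ a, Z a ∈ smoothSections T) ∧
        LinearIndependent ℝ fun a => Z a t}
  choose Z hZ hZt using fun t : β => t.2
  have hρ : ∀ t : β, ∃ ρ : ℝ, 0 < ρ ∧ ρ ≤ 1 ∧
      ∀ s ∈ Metric.ball t.1 ρ, LinearIndependent ℝ fun a => Z t a s := fun t => by
    obtain ⟨ρ, hρ, h⟩ := Metric.eventually_nhds_iff_ball.1
      (eventually_linearIndependent (fun a => (hZ t a).1) (hZt t))
    exact ⟨min ρ 1, lt_min hρ one_pos, min_le_right _ _, fun s hs =>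
      h s (Metric.ball_subset_ball (min_le_left _ _) hs)⟩
  choose ρ hρ0 hρ1 hρ using hρ
  -- Besicovitch gives a number `N`, independent of the cover, of disjoint subfamilies of intervals.
  -- Within one subfamily at most one local system is active at each time, so summing bump multiples
  -- preserves independence.
  obtain ⟨N, τ, hτ, hN⟩ := HasBesicovitchCovering.no_satelliteConfig (α := ℝ)
  obtain ⟨S, hS, hcov⟩ := Besicovitch.exist_disjoint_covering_families hτ hN
    (⟨Subtype.val, ρ, hρ0, 1, hρ1⟩ : Besicovitch.BallPackage β ℝ)
  have hdisj : ∀ i, (S i).PairwiseDisjoint fun j : β => Metric.ball j.1 (ρ j) := fun i =>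
    (hS i).mono fun j => Metric.ball_subset_closedBall
  have hcount : ∀ i, (S i).Countable := fun i =>
    (hdisj i).countable_of_isOpen (fun j _ => Metric.isOpen_ball)
      fun j _ => ⟨j.1, Metric.mem_ball_self (hρ0 j)⟩
  let φ : β → ℝ → ℝ := fun j s => expNegInvGlue (ρ j ^ 2 - (s - j.1) ^ 2)
  have hφsm : ∀ j, ContDiff ℝ ∞ (φ j) := fun j =>
    expNegInvGlue.contDiff.comp (contDiff_const.sub ((contDiff_id.sub contDiff_const).pow 2))
  have hφ : ∀ j s, φ j s ≠ 0 ↔ s ∈ Metric.ball j.1 (ρ j) := fun j s => by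
    simp only [φ, ne_eq, expNegInvGlue.zero_iff_nonpos, not_le, sub_pos, Metric.mem_ball,
      Real.dist_eq]
    rw [sq_lt_sq, abs_of_pos (hρ0 j)]
  have hsum : ∀ i a, ∃ ε : S i → ℝ, (∀ j, 0 < ε j) ∧
      ContDiff ℝ ∞ fun q : ℝ × (Fin n → ℝ) =>
        ∑' j : S i, ε j • (φ j.1 q.1 • Z j.1 a q.1 q.2) := fun i a => by
    have := (hcount i).to_subtype
    exact exists_contDiff_tsum_smul (fun (j : S i) (q : ℝ × (Fin n → ℝ)) =>
      φ j.1 q.1 • Z j.1 a q.1 q.2) fun j => ((hφsm j.1).comp contDiff_fst).smul (hZ j.1 a).1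
  choose ε hε hsm using hsum
  let V : Fin N → Fin k → TDVectorField n := fun i a t x =>
    ∑' j : S i, ε i a j • (φ j.1 t • Z j.1 a t x)
  have hV : ∀ i a t (j : S i), t ∈ Metric.ball j.1.1 (ρ j.1) →
      V i a t = (ε i a j * φ j.1 t) • Z j.1 a t := fun i a t j hj => by
    funext x
    change ∑' j : S i, ε i a j • (φ j.1 t • Z j.1 a t x) = _
    rw [tsum_eq_single j fun j' hj' => ?_, smul_smul]
    · rfl
    · have : φ j'.1 t = 0 := by
        by_contra hne
        have h1 := (hφ _ _).1 hne
        refine hj' (Subtype.ext ?_)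
        exact (hdisj i).elim_set j'.2 j.2 t h1 hj
      rw [this, zero_smul, smul_zero]
  refine ⟨N, V, fun i a => ⟨hsm i a, fun t => ?_⟩, fun t ht => ?_⟩
  · by_cases h : ∃ j : S i, t ∈ Metric.ball j.1.1 (ρ j.1)
    · obtain ⟨j, hj⟩ := h
      rw [hV i a t j hj]
      exact (T t).smul_mem _ ((hZ j.1 a).2 t)
    · push Not at h
      have : V i a t = 0 := by
        funext x
        change ∑' j : S i, ε i a j • (φ j.1 t • Z j.1 a t x) = 0
        refine (tsum_congr fun j => ?_).trans tsum_zero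
        rw [not_ne_iff.1 fun hne => h j ((hφ _ _).1 hne), zero_smul, smul_zero]
      rw [this]
      exact (T t).zero_mem
  · have h1 := hcov ⟨(⟨t, ht⟩ : β), rfl⟩
    simp only [mem_iUnion] at h1
    obtain ⟨i, j, hj, hjt⟩ := h1
    refine ⟨i, ?_⟩
    have h2 : (fun a => V i a t) = fun a =>
        (Units.mk0 (ε i a ⟨j, hj⟩ * φ j t)
          (mul_ne_zero (hε i a _).ne' ((hφ j t).2 hjt))) • Z j a t := by
      funext a
      exact hV i a t ⟨j, hj⟩ hjt
    rw [h2]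
    exact (hρ j t hjt).units_smul _

/-- Spaces of sections of bounded rank are spanned at every time by finitely many sections. -/
theorem exists_spanning_sections {m : ℕ}
    (hT : Dense {t | ∃ p : Fin m → Fin n → ℝ, ∀ z ∈ T t, (∀ i, z (p i) = 0) → z = 0}) :
    ∃ (r : ℕ) (V : Fin r → TDVectorField n), (∀ j, V j ∈ smoothSections T) ∧
      ∀ Z ∈ smoothSections T, ∀ t, Z t ∈ Submodule.span ℝ (range fun j => V j t) := by
  classical
  choose N V hV hVind using exists_independent_sections T
  let ι := Σ k : Fin (m * n + 1), Fin (N k) × Fin k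
  let e : ι ≃ Fin (Fintype.card ι) := Fintype.equivFin ι
  let F : ι → TDVectorField n := fun x => V x.1 x.2.1 x.2.2
  refine ⟨Fintype.card ι, fun j => F (e.symm j),
    fun j => hV _ _ _, fun Z hZ t => ?_⟩
  by_contra hmem
  let p : ℕ → Prop := fun k => ∃ Z : Fin k → TDVectorField n, (∀ a, Z a ∈ smoothSections T) ∧
    LinearIndependent ℝ fun a => Z a t
  have hp : ∀ k, p k → k ≤ m * n := fun k ⟨Z, hZ, h⟩ => card_le_of_linearIndependent hT hZ h
  have hp0 : p 0 := ⟨Fin.elim0, fun a => a.elim0, linearIndependent_empty_type⟩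
  -- With `k` the greatest number of independent sections at `t`, a value `Z t` outside the span
  -- would yield `k + 1` of them.
  have hk := Nat.findGreatest_spec (P := p) (Nat.zero_le (m * n)) hp0
  set k := Nat.findGreatest p (m * n) with hkdef
  obtain ⟨i, hi⟩ := hVind k t hk
  have hsub : Submodule.span ℝ (range fun a => V k i a t) ≤ Submodule.span ℝ
      (range fun j => F (e.symm j) t) := by
    refine Submodule.span_mono ?_
    rintro _ ⟨a, rfl⟩
    let x : ι := ⟨⟨k, Nat.lt_succ_of_le (hp k hk)⟩, i, a⟩
    exact ⟨e x, congrArg (fun x => F x t) (e.symm_apply_apply x)⟩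
  have hcons : p (k + 1) := by
    refine ⟨Fin.cons Z (V k i), fun a => ?_, ?_⟩
    · refine Fin.cases ?_ (fun a => ?_) a
      · simpa using hZ
      · simpa using hV k i a
    · have : (fun a => (Fin.cons Z (V k i) : Fin (k + 1) → TDVectorField n) a t) =
          Fin.cons (Z t) fun a => V k i a t := by
        funext a
        refine Fin.cases ?_ (fun a => ?_) a <;> simp
      rw [this, linearIndependent_finCons]
      exact ⟨hi, fun h => hmem (hsub h)⟩
  exact absurd (Nat.le_findGreatest (hp _ hcons) hcons) (by omega)

end Generators

/-! ### Fields tangent to the leaves of a rule. -/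

section Tangency

variable {n m : ℕ}

/-- The autonomous field `z`, together with `a ∂/∂t`, is at time `t` tangent to the leaves
`k = const` described by `Φ`. -/
def IsTangentTo (Ω : Set (ℝ × (Fin m → Fin n → ℝ) × (Fin n → ℝ)))
    (Φ : ℝ → (Fin m → Fin n → ℝ) → (Fin n → ℝ) → (Fin n → ℝ)) (a t : ℝ)
    (z : (Fin n → ℝ) → Fin n → ℝ) : Prop :=
  ∀ x k, (t, x, k) ∈ Ω →
    fderiv ℝ (fun q : ℝ × (Fin m → Fin n → ℝ) × (Fin n → ℝ) => Φ q.1 q.2.1 q.2.2) (t, x, k)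
      (a, fun i => z (x i), 0) = z (Φ t x k)

/-- The autonomous fields that are vertically tangent at time `t`. -/
def tangentSpaceAt (Ω : Set (ℝ × (Fin m → Fin n → ℝ) × (Fin n → ℝ)))
    (Φ : ℝ → (Fin m → Fin n → ℝ) → (Fin n → ℝ) → (Fin n → ℝ)) (t : ℝ) :
    Submodule ℝ ((Fin n → ℝ) → Fin n → ℝ) where
  carrier := {z | IsTangentTo Ω Φ 0 t z}
  add_mem' := fun {z z'} h h' x k hk => by
    have : ((0 : ℝ), (fun i => (z + z') (x i)), (0 : Fin n → ℝ)) =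
        (0, (fun i => z (x i)), 0) + (0, (fun i => z' (x i)), 0) := by
      refine Prod.ext (by simp) (Prod.ext (by ext; simp) (by simp))
    rw [this, map_add, h x k hk, h' x k hk]
    rfl
  zero_mem' := fun x k hk => by
    have : ((0 : ℝ), (fun i => (0 : (Fin n → ℝ) → Fin n → ℝ) (x i)), (0 : Fin n → ℝ)) = 0 := rfl
    rw [this, map_zero]
    rfl
  smul_mem' := fun c z h x k hk => by
    have : ((0 : ℝ), (fun i => (c • z) (x i)), (0 : Fin n → ℝ)) =
        c • (0, (fun i => z (x i)), 0) := by
      refine Prod.ext (by simp) (Prod.ext (by ext; simp) (by simp))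
    rw [this, map_smul, h x k hk]
    rfl

variable {Ω : Set (ℝ × (Fin m → Fin n → ℝ) × (Fin n → ℝ))}
  {Φ : ℝ → (Fin m → Fin n → ℝ) → (Fin n → ℝ) → (Fin n → ℝ)}

theorem IsTangentTo.sub {a t : ℝ} {z z' : (Fin n → ℝ) → Fin n → ℝ} (h : IsTangentTo Ω Φ a t z)
    (h' : IsTangentTo Ω Φ a t z') : z - z' ∈ tangentSpaceAt Ω Φ t := fun x k hk => by
  have : ((0 : ℝ), (fun i => (z - z') (x i)), (0 : Fin n → ℝ)) =
      (a, (fun i => z (x i)), 0) - (a, (fun i => z' (x i)), 0) := by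
    refine Prod.ext (by simp) (Prod.ext (by ext; simp) (by simp))
  rw [this, map_sub, h x k hk, h' x k hk]
  rfl

theorem IsTangentTo.add_mem {a t : ℝ} {z z' : (Fin n → ℝ) → Fin n → ℝ}
    (h : IsTangentTo Ω Φ a t z) (h' : z' ∈ tangentSpaceAt Ω Φ t) :
    IsTangentTo Ω Φ a t (z + z') := fun x k hk => by
  have : (a, (fun i => (z + z') (x i)), (0 : Fin n → ℝ)) =
      (a, (fun i => z (x i)), 0) + (0, (fun i => z' (x i)), 0) := by
    refine Prod.ext (by simp) (Prod.ext (by ext; simp) (by simp))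
  rw [this, map_add, h x k hk, h' x k hk]
  rfl

/-- The vertical part of the Lie bracket of autonomizations. -/
noncomputable def bracketField (Z Z' : TDVectorField n) : TDVectorField n := fun t x =>
  fderiv ℝ (fun q : ℝ × (Fin n → ℝ) => Z' q.1 q.2) (t, x) (1, Z t x) -
    fderiv ℝ (fun q : ℝ × (Fin n → ℝ) => Z q.1 q.2) (t, x) (1, Z' t x)

theorem TDVectorField.Smooth.bracketField {Z Z' : TDVectorField n} (hZ : Z.Smooth)
    (hZ' : Z'.Smooth) : (bracketField Z Z').Smooth := by
  have h : ∀ {Z Z' : TDVectorField n}, Z.Smooth → Z'.Smooth → ContDiff ℝ ∞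
      (fun q : ℝ × (Fin n → ℝ) =>
        fderiv ℝ (fun q : ℝ × (Fin n → ℝ) => Z' q.1 q.2) (q.1, q.2) (1, Z q.1 q.2)) :=
    fun hZ hZ' => (ContDiff.fderiv_right hZ' (by simp)).clm_apply (contDiff_const.prodMk hZ)
  exact (h hZ hZ').sub (h hZ' hZ)

/-- The prolongation of a field to the configuration space with constants. -/
def prolong (m : ℕ) (Z : TDVectorField n) (q : ℝ × (Fin m → Fin n → ℝ) × (Fin n → ℝ)) :
    ℝ × (Fin m → Fin n → ℝ) × (Fin n → ℝ) :=
  (1, fun i => Z q.1 (q.2.1 i), 0)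

theorem hasFDerivAt_prolong {Z : TDVectorField n} (hZ : Z.Smooth)
    (q : ℝ × (Fin m → Fin n → ℝ) × (Fin n → ℝ)) :
    ∃ D : ℝ × (Fin m → Fin n → ℝ) × (Fin n → ℝ) →L[ℝ] ℝ × (Fin m → Fin n → ℝ) × (Fin n → ℝ),
      HasFDerivAt (prolong m Z) D q ∧ ∀ v, D v = (0, (fun i =>
        fderiv ℝ (fun q : ℝ × (Fin n → ℝ) => Z q.1 q.2) (q.1, q.2.1 i) (v.1, v.2.1 i)), 0) := by
  let pt : Fin m → ℝ × (Fin m → Fin n → ℝ) × (Fin n → ℝ) →L[ℝ] ℝ × (Fin n → ℝ) := fun i =>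
    (ContinuousLinearMap.fst ℝ _ _).prod (ContinuousLinearMap.proj i ∘L
      ContinuousLinearMap.fst ℝ _ _ ∘L ContinuousLinearMap.snd ℝ _ _)
  refine ⟨_, (hasFDerivAt_const (1 : ℝ) q).prodMk ((hasFDerivAt_pi.2 fun i =>
    HasFDerivAt.comp (f := pt i) q (ContDiff.differentiable hZ (by simp) (pt i q)).hasFDerivAt
      (pt i).hasFDerivAt).prodMk (hasFDerivAt_const (0 : Fin n → ℝ) q)), fun v => ?_⟩
  rfl

/-- Tangency says that the prolongation and the autonomization are related by `(t, x, k) ↦ (t, Φ)`,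
and brackets of related fields are related. The `∂/∂t` parts cancel in the bracket. -/
theorem bracketField_mem_tangentSpaceAt {Z Z' : TDVectorField n} (hΩ : IsOpen Ω)
    (hΦ : ContDiffOn ℝ ∞ (fun q : ℝ × (Fin m → Fin n → ℝ) × (Fin n → ℝ) => Φ q.1 q.2.1 q.2.2) Ω)
    (hZ : Z.Smooth) (hZ' : Z'.Smooth) (h : ∀ t, IsTangentTo Ω Φ 1 t (Z t))
    (h' : ∀ t, IsTangentTo Ω Φ 1 t (Z' t)) (t : ℝ) :
    bracketField Z Z' t ∈ tangentSpaceAt Ω Φ t := by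
  intro x k hk
  set Ψ : ℝ × (Fin m → Fin n → ℝ) × (Fin n → ℝ) → Fin n → ℝ := fun q => Φ q.1 q.2.1 q.2.2 with hΨ
  set q : ℝ × (Fin m → Fin n → ℝ) × (Fin n → ℝ) := (t, x, k) with hq
  have hΨq : ContDiffAt ℝ ∞ Ψ q := hΦ.contDiffAt (hΩ.mem_nhds hk)
  obtain ⟨D, hD, hDv⟩ := hasFDerivAt_prolong (m := m) hZ q
  obtain ⟨D', hD', hDv'⟩ := hasFDerivAt_prolong (m := m) hZ' q
  have key := VectorField.fderiv_apply_lieBracket (V := prolong m Z) (W := prolong m Z') hΨq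
    (by rw [minSmoothness_of_isRCLikeNormedField]; exact WithTop.coe_le_coe.2 (le_top : (2 : ℕ∞) ≤ ⊤)) hD'.differentiableAt hD.differentiableAt
  have hT : ∀ {Z : TDVectorField n}, (∀ t, IsTangentTo Ω Φ 1 t (Z t)) → ∀ p ∈ Ω,
      fderiv ℝ Ψ p (prolong m Z p) = Z p.1 (Ψ p) := fun h p hp => h p.1 p.2.1 p.2.2 hp
  have hder : ∀ {Z Z' : TDVectorField n}, Z'.Smooth → (∀ t, IsTangentTo Ω Φ 1 t (Z t)) →
      (∀ t, IsTangentTo Ω Φ 1 t (Z' t)) →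
      fderiv ℝ (fun p => fderiv ℝ Ψ p (prolong m Z' p)) q (prolong m Z q) =
        fderiv ℝ (fun q : ℝ × (Fin n → ℝ) => Z' q.1 q.2) (t, Φ t x k) (1, Z t (Φ t x k)) := by
    intro Z Z' hZ' h h'
    have e1 : (fun p => fderiv ℝ Ψ p (prolong m Z' p)) =ᶠ[𝓝 q] fun p => Z' p.1 (Ψ p) := by
      filter_upwards [hΩ.mem_nhds hk] with p hp using hT h' p hp
    have e2 : HasFDerivAt (fun p => (p.1, Ψ p)) ((ContinuousLinearMap.fst ℝ _ _).prod
        (fderiv ℝ Ψ q)) q :=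
      hasFDerivAt_fst.prodMk (hΨq.differentiableAt (by simp)).hasFDerivAt
    have e3 : HasFDerivAt (fun p => Z' p.1 (Ψ p)) _ q := HasFDerivAt.comp
      (g := fun q : ℝ × (Fin n → ℝ) => Z' q.1 q.2) q
      (ContDiff.differentiable hZ' (by simp) (q.1, Ψ q)).hasFDerivAt e2
    rw [e1.fderiv_eq, e3.fderiv, ContinuousLinearMap.comp_apply, ContinuousLinearMap.prod_apply,
      hT h q hk]
    rfl
  rw [hder hZ' h h', hder hZ h' h, VectorField.lieBracket, hD.fderiv, hD'.fderiv, hDv, hDv'] at key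
  rw [bracketField, ← key]
  congr 1
  simp [prolong, hq, bracketField]
  rfl

end Tangency

/-! ### Existence of solutions, and extraction of the fields from a rule. -/

section Solutions

variable {n m : ℕ}

/-- An integral curve of the autonomization has a first component with derivative `1`, hence equal
to `t`. -/
theorem TDVectorField.Smooth.exists_isSolution {Y : TDVectorField n} (hY : Y.Smooth) (t₀ : ℝ)
    (y₀ : Fin n → ℝ) :
    ∃ ε > 0, ∃ y, y t₀ = y₀ ∧ Y.IsSolution (t₀ - ε) (t₀ + ε) y := by
  have hs : ContDiffAt ℝ 1 Y.autonomization (t₀, y₀) :=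
    (contDiff_const.prodMk ((ContDiff.of_le hY (by exact_mod_cast le_top)))).contDiffAt
  obtain ⟨c, hc0, ε, hε, hc⟩ :=
    hs.exists_forall_mem_closedBall_exists_eq_forall_mem_Ioo_hasDerivAt₀ t₀
  have h1 : EqOn (fun t => (c t).1) id (Ioo (t₀ - ε) (t₀ + ε)) :=
    ODE_solution_unique_of_mem_Ioo (v := fun _ _ => (1 : ℝ)) (s := fun _ => univ) (K := 0)
      (t₀ := t₀) (fun _ _ => (LipschitzWith.const _).lipschitzOnWith)
      ⟨by linarith, by linarith⟩
      (fun t ht => ⟨HasFDerivAt.comp_hasDerivAt (f := c) t hasFDerivAt_fst (hc t ht), trivial⟩)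
      (fun t _ => ⟨hasDerivAt_id t, trivial⟩) (by rw [hc0]; rfl)
  refine ⟨ε, hε, fun t => (c t).2, by simp only [hc0], fun t ht => ?_⟩
  have h2 : HasDerivAt (fun t => (c t).2) (Y (c t).1 (c t).2) t :=
    HasFDerivAt.comp_hasDerivAt (f := c) t hasFDerivAt_snd (hc t ht)
  rwa [show (c t).1 = t from h1 ht] at h2

/-- Solutions with given initial values, on a common interval. -/
theorem TDVectorField.Smooth.exists_isSolution_family {ι : Type*} [Finite ι]
    {Y : TDVectorField n} (hY : Y.Smooth) (t₀ : ℝ) (p : ι → Fin n → ℝ) :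
    ∃ ε > 0, ∃ x : ι → ℝ → Fin n → ℝ, (∀ i, x i t₀ = p i) ∧
      ∀ i, Y.IsSolution (t₀ - ε) (t₀ + ε) (x i) := by
  choose ε hε x hx hsol using fun i => hY.exists_isSolution t₀ (p i)
  have h1 : ∀ᶠ δ in 𝓝[>] (0 : ℝ), ∀ i, δ ≤ ε i :=
    eventually_all.2 fun i => nhdsWithin_le_nhds (eventually_le_nhds (hε i))
  obtain ⟨δ, hδ, hδ0⟩ := (h1.and self_mem_nhdsWithin).exists
  exact ⟨δ, hδ0, x, hx, fun i t ht => hsol i t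
    ⟨by linarith [ht.1, hδ i], by linarith [ht.2, hδ i]⟩⟩

variable {Λ : Type*} {Y : Λ → TDVectorField n} {t₀ : ℝ} {p : Fin m → Fin n → ℝ}
  {Ω : Set (ℝ × (Fin m → Fin n → ℝ) × (Fin n → ℝ))}
  {Φ : ℝ → (Fin m → Fin n → ℝ) → (Fin n → ℝ) → (Fin n → ℝ)}

/-- Through any point of `Ω` pass solutions with `k` fixed; differentiating `solves` along them
gives tangency. -/
theorem IsSuperpositionRuleAt.isTangentTo (h : IsSuperpositionRuleAt Y t₀ p Ω Φ)
    (hY : ∀ α, (Y α).Smooth) (α : Λ) (t : ℝ) : IsTangentTo Ω Φ 1 t (Y α t) := by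
  intro x k hk
  obtain ⟨ε, hε, c, hc0, hc⟩ := (hY α).exists_isSolution_family t x
  have hct : (fun i => c i t) = x := funext hc0
  have ht : t ∈ Ioo (t - ε) (t + ε) := ⟨by linarith, by linarith⟩
  have hcd : HasDerivAt (fun s => (s, (fun i => c i s), k)) (1, (fun i => Y α t (x i)), 0) t := by
    refine (hasDerivAt_id t).prodMk ((hasDerivAt_pi.2 fun i => ?_).prodMk (hasDerivAt_const t k))
    rw [← hc0 i]
    exact hc i t ht
  have hmem : ∀ᶠ s in 𝓝 t, (s, (fun i => c i s), k) ∈ Ω :=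
    hcd.continuousAt.eventually (p := fun q => q ∈ Ω)
      (h.isOpen_domain.mem_nhds (by simp only [hct]; exact hk))
  obtain ⟨δ, hδ, hball⟩ := Metric.eventually_nhds_iff_ball.1 hmem
  have hsol := h.solves α (t - min ε δ) (t + min ε δ) c k
    (fun i s hs => hc i s ⟨by linarith [hs.1, min_le_left ε δ], by linarith [hs.2, min_le_left ε δ]⟩)
    (fun s hs => hball s (by
      rw [Real.ball_eq_Ioo]
      exact ⟨by linarith [hs.1, min_le_right ε δ], by linarith [hs.2, min_le_right ε δ]⟩))
  have hpos : 0 < min ε δ := lt_min hε hδ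
  have h1 := hsol t ⟨by linarith, by linarith⟩
  simp only [hct] at h1
  have h2 : HasDerivAt (fun s => Φ s (fun i => c i s) k) _ t :=
    HasFDerivAt.comp_hasDerivAt (f := fun s => (s, (fun i => c i s), k))
      (l := fun q : ℝ × (Fin m → Fin n → ℝ) × (Fin n → ℝ) => Φ q.1 q.2.1 q.2.2) t
      (((h.smooth.contDiffAt (h.isOpen_domain.mem_nhds (by simp only [hct]; exact hk))
        ).differentiableAt (by simp)).hasFDerivAt) hcd
  have h3 := h2.unique h1
  simpa only [hct] using h3

theorem IsSuperpositionRuleAt.exists_constant (h : IsSuperpositionRuleAt Y t₀ p Ω Φ)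
    (hY : ∀ α, (Y α).Smooth) (α : Λ) (y : Fin n → ℝ) :
    ∃ k, (t₀, p, k) ∈ Ω ∧ Φ t₀ p k = y := by
  obtain ⟨ε, hε, c, hc0, hc⟩ := (hY α).exists_isSolution_family t₀
    (fun i : Option (Fin m) => i.elim y p)
  obtain ⟨k, hk, he⟩ := h.general α (t₀ - ε) (t₀ + ε) (fun i => c (some i)) (c none)
    ⟨by linarith, by linarith⟩ (fun i => hc _) (fun i => hc0 _) (hc _)
  refine ⟨k, hk, ?_⟩
  have h1 := he.self_of_nhds
  rw [show (fun i => c (some i) t₀) = p from funext fun i => hc0 (some i)] at h1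
  rw [← h1]
  exact hc0 none

/-- Every `y` is some `Φ t₀ p k`, and tangency expresses `z y` linearly through the values `z (p
i)`. -/
theorem IsSuperpositionRuleAt.eq_zero_of_mem (h : IsSuperpositionRuleAt Y t₀ p Ω Φ)
    (hY : ∀ α, (Y α).Smooth) (α : Λ) {z : (Fin n → ℝ) → Fin n → ℝ}
    (hz : z ∈ tangentSpaceAt Ω Φ t₀) (hzp : ∀ i, z (p i) = 0) : z = 0 := by
  funext y
  obtain ⟨k, hk, rfl⟩ := h.exists_constant hY α y
  rw [← hz p k hk]
  simp only [hzp]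
  exact map_zero _

/-- A Lie family is spanned by finitely many fields closed under brackets. -/
theorem exists_fields_of_isLieFamily (hY : ∀ α, (Y α).Smooth) (hL : IsLieFamily Y) :
    ∃ (r : ℕ) (X : Fin r → TDVectorField n) (b : Λ → Fin r → ℝ → ℝ)
      (f : Fin r → Fin r → Fin r → ℝ → ℝ), (∀ j, (X j).Smooth) ∧ IsClosedUnderBrackets X f ∧
      (∀ α t, ∑ j, b α j t = 1) ∧
      ∀ α t x, (Y α).autonomization (t, x) = ∑ j, b α j t • (X j).autonomization (t, x) := by
  rcases isEmpty_or_nonempty Λ with hΛ | ⟨⟨α₀⟩⟩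
  · exact ⟨0, Fin.elim0, fun α => isEmptyElim α, Fin.elim0, fun j => j.elim0, fun j => j.elim0,
      fun α => isEmptyElim α, fun α => isEmptyElim α⟩
  obtain ⟨m, W, -, hWd, hW⟩ := hL
  choose Ω Φ hR using fun w : W => hW w.1.1 w.1.2 w.2
  let T : ℝ → Submodule ℝ ((Fin n → ℝ) → Fin n → ℝ) := fun t => ⨅ w, tangentSpaceAt (Ω w) (Φ w) t
  have hT : Dense {t | ∃ p : Fin m → Fin n → ℝ, ∀ z ∈ T t, (∀ i, z (p i) = 0) → z = 0} := by
    refine hWd.mono ?_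
    rintro _ ⟨w, hw, rfl⟩
    exact ⟨w.2, fun z hz hzp => (hR ⟨w, hw⟩).eq_zero_of_mem hY α₀
      ((Submodule.mem_iInf _).1 hz ⟨w, hw⟩) hzp⟩
  obtain ⟨r, V, hV, hspan⟩ := exists_spanning_sections hT
  have hcoef : ∀ Z ∈ smoothSections T, ∃ c : Fin r → ℝ → ℝ,
      ∀ t, Z t = ∑ j, c j t • V j t := fun Z hZ => by
    choose c hc using fun t => (Submodule.mem_span_range_iff_exists_fun ℝ).1 (hspan Z hZ t)
    exact ⟨fun j t => c t j, fun t => (hc t).symm⟩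
  -- The `V j` are vertical directions; adding `Y α₀` makes them differences of autonomizations,
  -- with time component `1` restored.
  let X : Fin (r + 1) → TDVectorField n := Fin.cons (Y α₀) fun j => Y α₀ + V j
  have hXtan : ∀ j w t, IsTangentTo (Ω w) (Φ w) 1 t (X j t) := fun j w t => by
    refine Fin.cases ?_ (fun j => ?_) j
    · exact (hR w).isTangentTo hY α₀ t
    · exact ((hR w).isTangentTo hY α₀ t).add_mem ((Submodule.mem_iInf _).1 ((hV j).2 t) w)
  have hXsm : ∀ j, (X j).Smooth := fun j => by
    refine Fin.cases (hY α₀) (fun j => ?_) j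
    exact ContDiff.add (hY α₀) (hV j).1
  have hbr : ∀ j k, bracketField (X j) (X k) ∈ smoothSections T := fun j k =>
    ⟨(hXsm j).bracketField (hXsm k), fun t => (Submodule.mem_iInf _).2 fun w =>
      bracketField_mem_tangentSpaceAt (hR w).isOpen_domain (hR w).smooth (hXsm j) (hXsm k)
        (hXtan j w) (hXtan k w) t⟩
  have hdiff : ∀ α, Y α - Y α₀ ∈ smoothSections T := fun α =>
    ⟨ContDiff.sub (hY α) (hY α₀), fun t => (Submodule.mem_iInf _).2 fun w =>
      ((hR w).isTangentTo hY α t).sub ((hR w).isTangentTo hY α₀ t)⟩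
  choose g hg using fun j k => hcoef _ (hbr j k)
  choose β hβ using fun α => hcoef _ (hdiff α)
  -- The coefficient of `Y α₀` is adjusted so that the total is `s`: `0` for brackets, `1` for the
  -- `Y α`.
  have hcomb : ∀ (s : ℝ) (c : Fin r → ℝ) (t : ℝ) (x : Fin n → ℝ),
      ∑ j, (Fin.cons (s - ∑ j, c j) c : Fin (r + 1) → ℝ) j • (X j).autonomization (t, x) =
        (s, s • Y α₀ t x + ∑ j, c j • V j t x) := fun s c t x => by
    rw [Fin.sum_univ_succ]
    simp only [Fin.cons_zero, Fin.cons_succ, X, TDVectorField.autonomization]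
    refine Prod.ext ?_ ?_
    · simp [Prod.fst_sum]
    · simp [Prod.snd_sum, Finset.sum_add_distrib, sub_smul, Finset.sum_smul]
      abel
  refine ⟨r + 1, X, fun α j t => (Fin.cons (1 - ∑ j, β α j t) (fun j => β α j t) :
      Fin (r + 1) → ℝ) j,
    fun j k l t => (Fin.cons (0 - ∑ l, g j k l t) (fun l => g j k l t) : Fin (r + 1) → ℝ) l,
    hXsm, fun j k t x => ?_, fun α t => ?_, fun α t x => ?_⟩
  · rw [hcomb, lieBracket_autonomization (hXsm j) (hXsm k)]
    refine Prod.ext rfl ?_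
    have := congrFun (hg j k t) x
    simp only [Finset.sum_apply, Pi.smul_apply] at this
    simpa [bracketField] using this
  · simp [Fin.sum_univ_succ]
  · rw [hcomb]
    refine Prod.ext rfl ?_
    have := congrFun (hβ α t) x
    simp only [Finset.sum_apply, Pi.smul_apply, Pi.sub_apply] at this
    simp only [TDVectorField.autonomization, one_smul]
    rw [← this]
    abel

end Solutions

theorem mainTheorem1 {n : ℕ} {Λ : Type*} (Y : Λ → TDVectorField n) (hY : ∀ α, (Y α).Smooth) :
    IsLieFamily Y ↔
      ∃ (r : ℕ) (X : Fin r → TDVectorField n) (b : Λ → Fin r → ℝ → ℝ)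
        (f : Fin r → Fin r → Fin r → ℝ → ℝ),
        (∀ j, (X j).Smooth) ∧
        (∀ j k t x,
          VectorField.lieBracket ℝ (X j).autonomization (X k).autonomization (t, x) =
            ∑ l, f j k l t • (X l).autonomization (t, x)) ∧
        (∀ α t, ∑ j, b α j t = 1) ∧
        (∀ α t x, (Y α).autonomization (t, x) =
          ∑ j, b α j t • (X j).autonomization (t, x)) :=
  ⟨exists_fields_of_isLieFamily hY, fun ⟨_, _, _, _, hX, hf, hb, hYX⟩ =>
    isLieFamily_of_fields hY hX hf hb hYX⟩
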